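/- Setting. Let $E,H$ be finite-dimensional real vector spaces with duals $E^*,H^*$ and pairings $\langle\cdot,\cdot\rangle$, let $K\subset E$ be a regular cone (closed, convex, pointed, with nonempty interior) with dual cone $K^*=\{s\in E^*:\langle s,x\rangle\ge 0\ \forall x\in K\}$, and let $F$ be a $\nu$-normal barrier for $K$, that is, a convex $C^3$ function on $\operatorname{int}K$ tending to $+\infty$ at the boundary of $K$, with $|\nabla^3F(x)[h,h,h]|\le 2\langle\nabla^2F(x)h,h\rangle^{3/2}$ and $F(\tau x)=F(x)-\nu\ln\tau$ for all $x\in\operatorname{int}K$, $h\in E$, $\tau>0$. Let $F_*(s)=\max_{x\in\operatorname{int}K}\{-\langle s,x\rangle-F(x)\}$ for $s\in\operatorname{int}K^*$. Let $A:E\to H^*$ be a surjective linear map with adjoint $A^*:H\to E^*$, and let $b\in H^*$, $c\in E^*$. Consider the problem $\min\{\langle c,x\rangle: Ax=b,\ x\in K\}$ and its dual $$f^*=\max\{\langle b,y\rangle:\ y\in Q\},\qquad Q=\{y\in H:\ s(y):=c-A^*y\in K^*\},$$ and assume strict feasibility: there are $x_0\in\operatorname{int}K$, $s_0\in\operatorname{int}K^*$,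 $y_0\in H$ with $Ax_0=b$, $s_0+A^*y_0=c$. Put $f(y)=F_*(c-A^*y)$ for $y\in\operatorname{int}Q$. For $\mu>0$ let $(x_\mu,s_\mu,y_\mu)$ be the central path: $x_\mu\in\operatorname{int}K$, $Ax_\mu=b$, $c+\mu\nabla F(x_\mu)=A^*y_\mu$, $s_\mu=-\mu\nabla F(x_\mu)$. Let $B=\nabla^2F(x_1)$ (the value at $\mu=1$) and $G=AB^{-1}A^*$, with norms $\|x\|_B=\langle Bx,x\rangle^{1/2}$ on $E$ and $\|y\|_G=\langle Gy,y\rangle^{1/2}$ on $H$. For $y\in\operatorname{int}Q$ put $\|g\|_y=\langle g,[\nabla^2f(y)]^{-1}g\rangle^{1/2}$ for $g\in H^*$, and $v(y)=[\nabla^2f(y)]^{-1}\nabla f(y)$, $y(\alpha)=y+\alpha v(y)$. For $\mu\in(0,1]$ and $\beta\ge0$ let $$\mathcal N(\mu,\beta)=\{y\in\operatorname{int}Q:\ \|\nabla f(y)-\tfrac1\mu b\|_y\le\beta\}.$$ Let $y_*$ be an optimal solution of the dual problem, $s_*=c-A^*y_*$, and assume that (1) there is $\gamma_d>0$ with $f^*-\langle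 b,y\rangle\ge\gamma_d\|y-y_*\|_G$ for all $y\in Q$; (2) there is $\sigma_d$ with $\|\nabla^2F_*(s_\mu)s_*\|_B\le\sigma_d$ for all $\mu\in(0,1]$. Theorem. Let $y\in\mathcal N(\mu,\beta)$ with $\mu\in(0,1]$ and $\beta\in[0,\frac19]$, and let $\kappa_2=\frac{2}{\gamma_d}\left(\sigma_d+\frac{6\nu^2}{\mu}\beta\right)$. Then, for every $r\in(0,1)$, the point $y(\hat\alpha)$ with $$\hat\alpha=\frac{r}{r+\kappa_2\,[f^*-\langle b,y\rangle]}$$ belongs to $Q$. Moreover, $$f^*-\langle b,y(\hat\alpha)\rangle\le\kappa_3\,[f^*-\langle b,y\rangle]^2,\qquad \kappa_3=\kappa_2\left(\frac1r+\frac{2\sqrt\nu}{\gamma_d}\right).$$ -/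

import Mathlib

open Set Filter Topology

noncomputable section

namespace ConicIPM

/-! ### Euclidean norms defined by self-adjoint operators -/

section Norms

variable {V : Type*} [NormedAddCommGroup V] [NormedSpace ℝ V]

/-- `‖x‖_B = ⟨B x, x⟩^{1/2}` for `x ∈ V`, where `B : V → V*`. -/
def opNorm (B : V →L[ℝ] StrongDual ℝ V) (x : V) : ℝ :=
  √(B x x)

/-- `‖s‖_B = ⟨s, B⁻¹ s⟩^{1/2}` for `s ∈ V*`, where `B : V → V*` is invertible. -/
def opDualNorm (B : V →L[ℝ] StrongDual ℝ V) (s : StrongDual ℝ V) : ℝ :=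
  √(s (B.inverse s))

/-- The gradient `∇Φ(x) ∈ V*`. -/
def grad (Φ : V → ℝ) (x : V) : StrongDual ℝ V :=
  fderiv ℝ Φ x

/-- The Hessian `∇²Φ(x) : V → V*`. -/
def hess (Φ : V → ℝ) (x : V) : V →L[ℝ] StrongDual ℝ V :=
  fderiv ℝ (fderiv ℝ Φ) x

/-- The canonical identification `V** = V` of a finite-dimensional space with its bidual. -/
def ofBidual (φ : StrongDual ℝ (StrongDual ℝ V)) : V :=
  (NormedSpace.inclusionInDoubleDual ℝ V).inverse φ

/-- `ofBidual φ` is the vector that represents `φ` : `⟨s, ofBidual φ⟩ = φ s`. -/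
theorem apply_ofBidual [FiniteDimensional ℝ V] (φ : StrongDual ℝ (StrongDual ℝ V))
    (s : StrongDual ℝ V) : s (ofBidual φ) = φ s := by
  have hinj : Function.Injective (NormedSpace.inclusionInDoubleDual ℝ V) := by
    intro x y hxy
    exact (SeparatingDual.eq_iff_forall_dual_eq (R := ℝ)).2 fun g => DFunLike.congr_fun hxy g
  have hdim : ∀ (W : Type _) [NormedAddCommGroup W] [NormedSpace ℝ W] [FiniteDimensional ℝ W],
      Module.finrank ℝ (StrongDual ℝ W) = Module.finrank ℝ W := by
    intro W _ _ _
    rw [← (LinearMap.toContinuousLinearMap : (W →ₗ[ℝ] ℝ) ≃ₗ[ℝ] (W →L[ℝ] ℝ)).finrank_eq]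
    exact Subspace.dual_finrank_eq
  have hfin : Module.finrank ℝ V = Module.finrank ℝ (StrongDual ℝ (StrongDual ℝ V)) := by
    rw [hdim, hdim]
  let e : V ≃L[ℝ] StrongDual ℝ (StrongDual ℝ V) :=
    (LinearEquiv.ofInjectiveOfFinrankEq
      (NormedSpace.inclusionInDoubleDual ℝ V).toLinearMap hinj hfin).toContinuousLinearEquiv
  have he : NormedSpace.inclusionInDoubleDual ℝ V = (e : V →L[ℝ] _) := by
    ext x g; rfl
  have h1 : NormedSpace.inclusionInDoubleDual ℝ V (ofBidual φ) = φ := by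
    unfold ofBidual
    rw [he, ContinuousLinearMap.inverse_equiv]
    simp
  have h2 := DFunLike.congr_fun h1 s
  simpa using h2

end Norms

/-! ### Regular cones and normal barriers -/

section Barriers

variable {V : Type*} [NormedAddCommGroup V] [NormedSpace ℝ V]

/-- A regular cone: closed, convex, pointed (it contains no line), with nonempty interior. -/
structure IsRegularCone (K : ConvexCone ℝ V) : Prop where
  isClosed : IsClosed (K : Set V)
  salient : K.Salient
  nonempty_interior : (interior (K : Set V)).Nonempty

/-- The dual cone `K* = {s ∈ V* : ⟨s, x⟩ ≥ 0 for all x ∈ K}`. -/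
def dualCone (K : ConvexCone ℝ V) : Set (StrongDual ℝ V) :=
  {s | ∀ x ∈ K, 0 ≤ s x}

/-- A `ν`-normal barrier for `K`: a `C³` convex function on `int K` that tends to `+∞` at the
boundary of `K`, is self-concordant, and is `ν`-logarithmically homogeneous. -/
structure IsNormalBarrier (K : ConvexCone ℝ V) (ν : ℝ) (F : V → ℝ) : Prop where
  contDiffOn : ContDiffOn ℝ 3 F (interior (K : Set V))
  convexOn : ConvexOn ℝ (interior (K : Set V)) F
  tendsto_boundary : ∀ z ∈ frontier (K : Set V),
    Tendsto F (𝓝[interior (K : Set V)] z) atTop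
  selfConcordant : ∀ x ∈ interior (K : Set V), ∀ h : V,
    |iteratedFDeriv ℝ 3 F x (fun _ => h)| ≤ 2 * (hess F x h h) ^ (3 / 2 : ℝ)
  logHomogeneous : ∀ x ∈ interior (K : Set V), ∀ τ : ℝ, 0 < τ →
    F (τ • x) = F x - ν * Real.log τ

/-- The dual barrier `F_*(s) = max {-⟨s, x⟩ - F(x) : x ∈ int K}`, used for `s ∈ int K*`. -/
def dualBarrier (K : ConvexCone ℝ V) (F : V → ℝ) (s : StrongDual ℝ V) : ℝ :=
  ⨆ x : interior (K : Set V), (-(s x) - F x)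

end Barriers

/-! ### The conic problem, its dual, and the central path -/

/-- The data of the conic problem `min {⟨c, x⟩ : A x = b, x ∈ K}` and a function `F` on the
primal space (the barrier) with its parameter `ν`. -/
structure ConicProblem (E H : Type*) [NormedAddCommGroup E] [NormedSpace ℝ E]
    [NormedAddCommGroup H] [NormedSpace ℝ H] where
  K : ConvexCone ℝ E
  A : E →L[ℝ] StrongDual ℝ H
  b : StrongDual ℝ H
  c : StrongDual ℝ E
  ν : ℝ
  F : E → ℝ

namespace ConicProblem

variable {E H : Type*} [NormedAddCommGroup E] [NormedSpace ℝ E]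
  [NormedAddCommGroup H] [NormedSpace ℝ H] (P : ConicProblem E H)

/-- The adjoint `A* : H → E*`, `⟨A* y, x⟩ = ⟨A x, y⟩`. -/
def Aadj : H →L[ℝ] StrongDual ℝ E :=
  P.A.flip

/-- The slack `s(y) = c - A* y`. -/
def slack (y : H) : StrongDual ℝ E :=
  P.c - P.Aadj y

/-- The dual feasible set `Q = {y ∈ H : c - A* y ∈ K*}`. -/
def Q : Set H :=
  {y | P.slack y ∈ dualCone P.K}

/-- Strict primal and dual feasibility. -/
def StrictlyFeasible : Prop :=
  (∃ x₀ ∈ interior (P.K : Set E), P.A x₀ = P.b) ∧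
    ∃ s₀ ∈ interior (dualCone P.K), ∃ y₀ : H, s₀ + P.Aadj y₀ = P.c

/-- The optimal value `f^* = max {⟨b, y⟩ : y ∈ Q}`. -/
def fStar : ℝ :=
  sSup (P.b '' P.Q)

/-- `y` solves the dual problem `max {⟨b, y⟩ : y ∈ Q}`. -/
def IsDualOptimal (y : H) : Prop :=
  y ∈ P.Q ∧ ∀ y' ∈ P.Q, P.b y' ≤ P.b y

/-- The dual barrier `F_*`. -/
def Fdual : StrongDual ℝ E → ℝ :=
  dualBarrier P.K P.F

/-- The barrier `f(y) = F_*(c - A* y)` of `Q`. -/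
def f (y : H) : ℝ :=
  P.Fdual (P.slack y)

/-- `(x, s, y)` is the point of the primal-dual central path with parameter `μ`. -/
def IsCentralPoint (μ : ℝ) (z : E × StrongDual ℝ E × H) : Prop :=
  z.1 ∈ interior (P.K : Set E) ∧ P.A z.1 = P.b ∧
    P.c + μ • grad P.F z.1 = P.Aadj z.2.2 ∧ z.2.1 = -(μ • grad P.F z.1)

/-- The central path `μ ↦ z_μ = (x_μ, s_μ, y_μ)`. For `μ > 0` this point exists and is unique when
`K` is regular, `F` is a normal barrier, `A` is surjective and both problems are strictly feasible. -/
def centralPath (μ : ℝ) : E × StrongDual ℝ E × H :=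
  Classical.epsilon (P.IsCentralPoint μ)

/-- `x_μ`. -/
def xC (μ : ℝ) : E := (P.centralPath μ).1

/-- `s_μ`. -/
def sC (μ : ℝ) : StrongDual ℝ E := (P.centralPath μ).2.1

/-- `B = ∇²F(x_μ)` with `μ = 1`. -/
def B : E →L[ℝ] StrongDual ℝ E :=
  hess P.F (P.xC 1)

/-- `G = A B⁻¹ A* : H → H*`. -/
def G : H →L[ℝ] StrongDual ℝ H :=
  P.A ∘L P.B.inverse ∘L P.Aadj

/-- Sharpness of the dual solution `yStar` with constant `γd`. -/
def SharpDual (yStar : H) (γd : ℝ) : Prop :=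
  0 < γd ∧ ∀ y ∈ P.Q, γd * opNorm P.G (y - yStar) ≤ P.fStar - P.b y

/-- Boundedness of `∇²F_*(s_μ) s_*` along the central path, where `s_* = c - A* y_*`. -/
def BoundedAlongPath (yStar : H) (σd : ℝ) : Prop :=
  ∀ μ ∈ Ioc (0 : ℝ) 1,
    opNorm P.B (ofBidual (hess P.Fdual (P.sC μ) (P.slack yStar))) ≤ σd

/-- The neighbourhood `N(μ, β)` of the central path:
`y ∈ int Q` with `‖∇f(y) - b/μ‖_y ≤ β`. -/
def neighborhood (μ β : ℝ) : Set H :=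
  {y | y ∈ interior P.Q ∧
    opDualNorm (hess P.f y) (grad P.f y - μ⁻¹ • P.b) ≤ β}

/-- The predictor direction `v(y) = [∇²f(y)]⁻¹ ∇f(y)`. -/
def v (y : H) : H :=
  (hess P.f y).inverse (grad P.f y)

/-- `κ₂ = (2/γ_d)(σ_d + 6 ν² β / μ)`. -/
def kappa₂ (γd σd μ β : ℝ) : ℝ :=
  2 / γd * (σd + 6 * P.ν ^ 2 / μ * β)

/-- `κ₃ = κ₂ (1/r + 2 √ν / γ_d)`. -/
def kappa₃ (γd σd μ β r : ℝ) : ℝ :=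
  P.kappa₂ γd σd μ β * (1 / r + 2 * √P.ν / γd)

/-- `α̂ = r / (r + κ₂ (f^* - ⟨b, y⟩))`. -/
def alphaHat (γd σd μ β r : ℝ) (y : H) : ℝ :=
  r / (r + P.kappa₂ γd σd μ β * (P.fStar - P.b y))

end ConicProblem

end ConicIPM

end

/-! Write `Δ = f^* - ⟨b, y⟩`, `d = y + v(y) - y_*`, and let `z = -∇F_*(s(y))` be the Legendre point
of `s(y)`. Then `∇f(y) = A z` and `∇²f(y) = A [∇²F(z)]⁻¹ A*`. Logarithmic homogeneity gives `z =
[∇²F(z)]⁻¹ s(y)`, so in `∇²f(y) d` the slack `s(y)` cancels and only `A w` remains, where `w =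
[∇²F(z)]⁻¹ s_* = ∇²F_*(s(y)) s_*` (`hess_f_predictor`).

Let `n` be the local norm of `d` at `y`. Pairing with `d` gives `n² = ⟨A* d, w⟩ ≤ ‖d‖_G ‖w‖_B`. The
Dikin ellipsoid at `y` lies in `Q`, and by sharpness its radius in `‖·‖_G` is at most `2Δ/γ_d`
(`opNorm_G_le`). So `‖d‖_G ≤ (2Δ/γ_d) n`, hence `n ≤ (2Δ/γ_d) ‖w‖_B`. Near the central path `‖w‖_B ≤
σ_d + 6ν²β/μ` (`opNorm_inverse_slack_le`), which yields `n ≤ κ₂ Δ`.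

Finally `y(α) = (1-α) y + α y_* + α d`. The error `α d` fits into the Dikin ellipsoid at `y` scaled
by `1-α` as soon as `α n ≤ 1-α`, and `α̂` ensures this. The new gap is `(1-α)Δ - α⟨b, d⟩`; both
terms are quadratic in `Δ`, because `1-α̂ ≤ κ₂Δ/r` and `|⟨b, d⟩| ≤ √ν ‖d‖_G`.

The local estimates rest on self-concordance of both `F` and `F_*`, which passes through the mixed
bound on third derivatives `abs_trilinear_le`. -/

noncomputable section

/-! ### Binary cubic forms. -/

namespace ConicIPM

/-- With `(C, S) = (cos θ, sin θ)` and `q = √3/2`, the three nodes are the directions `θ`, `θ +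
π/3`, `θ + 2π/3`, and the right side is `a cos 3θ + b sin 3θ`. Up to signs it is a convex
combination of values of the form at unit vectors; `cubic_interpolation_weights` says that the
weights sum to one. -/
theorem cubic_interpolation (a b c d C S q : ℝ) (hq : q ^ 2 = 3 / 4) (h : C ^ 2 + S ^ 2 = 1) :
    let p : ℝ → ℝ → ℝ := fun x y => a * x ^ 3 + 3 * b * x ^ 2 * y + 3 * c * x * y ^ 2 + d * y ^ 3
    let C1 := C / 2 - q * S
    let S1 := S / 2 + q * C
    let C2 := - C / 2 - q * S
    let S2 := - S / 2 + q * C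
    (4 / 3 * (S1 * S2)) ^ 2 * p C S - (4 / 3 * (S * S2)) ^ 2 * p C1 S1
        + (4 / 3 * (S * S1)) ^ 2 * p C2 S2
      = a * (C ^ 3 - 3 * C * S ^ 2) + b * (3 * C ^ 2 * S - S ^ 3) := by
  intro p C1 S1 C2 S2
  simp only [p, C1, S1, C2, S2]
  grind

theorem cubic_interpolation_weights (C S q : ℝ) (hq : q ^ 2 = 3 / 4) (h : C ^ 2 + S ^ 2 = 1) :
    let S1 := S / 2 + q * C
    let S2 := - S / 2 + q * C
    (4 / 3 * (S1 * S2)) ^ 2 + (4 / 3 * (S * S2)) ^ 2 + (4 / 3 * (S * S1)) ^ 2 = 1 := by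
  intro S1 S2
  simp only [S1, S2]
  grind

/-- The Bernstein–Szegő inequality for binary cubic forms. -/
theorem cubic_form_bound (a b c d M : ℝ)
    (hM : ∀ x y : ℝ, x ^ 2 + y ^ 2 = 1 →
      |a * x ^ 3 + 3 * b * x ^ 2 * y + 3 * c * x * y ^ 2 + d * y ^ 3| ≤ M)
    (x y : ℝ) : |a * x + b * y| ≤ M * √(x ^ 2 + y ^ 2) := by
  have hunit : ∀ φ : ℝ, |a * Real.cos φ + b * Real.sin φ| ≤ M := by
    intro φ
    set C := Real.cos (φ / 3)
    set S := Real.sin (φ / 3)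
    have h : C ^ 2 + S ^ 2 = 1 := Real.cos_sq_add_sin_sq _
    have hc : Real.cos φ = C ^ 3 - 3 * C * S ^ 2 := by
      rw [show φ = 3 * (φ / 3) by ring, Real.cos_three_mul]; grind
    have hs : Real.sin φ = 3 * C ^ 2 * S - S ^ 3 := by
      rw [show φ = 3 * (φ / 3) by ring, Real.sin_three_mul]; grind
    have hq : (√3 / 2) ^ 2 = (3 / 4 : ℝ) := by
      rw [div_pow, Real.sq_sqrt (by norm_num)]; norm_num
    have h1 := cubic_interpolation a b c d C S (√3 / 2) hq h
    have h2 := cubic_interpolation_weights C S (√3 / 2) hq h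
    generalize √3 / 2 = q at h1 h2 hq
    simp only at h1 h2
    have e0 := abs_le.1 (hM C S h)
    have e1 := abs_le.1 (hM (C / 2 - q * S) (S / 2 + q * C) (by grind))
    have e2 := abs_le.1 (hM (- C / 2 - q * S) (- S / 2 + q * C) (by grind))
    rw [hc, hs, ← h1]
    generalize (4 / 3 * ((S / 2 + q * C) * (- S / 2 + q * C))) = w0 at *
    generalize (4 / 3 * (S * (- S / 2 + q * C))) = w1 at *
    generalize (4 / 3 * (S * (S / 2 + q * C))) = w2 at *
    have hMM : M = w0 ^ 2 * M + w1 ^ 2 * M + w2 ^ 2 * M := by rw [← add_mul, ← add_mul, h2, one_mul]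
    have f0 := mul_le_mul_of_nonneg_left e0.1 (sq_nonneg w0)
    have f0' := mul_le_mul_of_nonneg_left e0.2 (sq_nonneg w0)
    have f1 := mul_le_mul_of_nonneg_left e1.1 (sq_nonneg w1)
    have f1' := mul_le_mul_of_nonneg_left e1.2 (sq_nonneg w1)
    have f2 := mul_le_mul_of_nonneg_left e2.1 (sq_nonneg w2)
    have f2' := mul_le_mul_of_nonneg_left e2.2 (sq_nonneg w2)
    rw [abs_le]
    constructor <;> linarith
  have hx := Complex.norm_mul_cos_arg (x + y * Complex.I)
  have hy := Complex.norm_mul_sin_arg (x + y * Complex.I)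
  rw [Complex.norm_add_mul_I] at hx hy
  simp only [Complex.add_re, Complex.ofReal_re, Complex.mul_re, Complex.I_re, Complex.ofReal_im,
    Complex.I_im, Complex.add_im, Complex.mul_im] at hx hy
  set φ := (↑x + ↑y * Complex.I).arg
  have h0 := Real.sqrt_nonneg (x ^ 2 + y ^ 2)
  calc |a * x + b * y| = |√(x ^ 2 + y ^ 2) * (a * Real.cos φ + b * Real.sin φ)| := by
        congr 1; linear_combination (-a) * hx - b * hy
    _ = √(x ^ 2 + y ^ 2) * |a * Real.cos φ + b * Real.sin φ| := by
        rw [abs_mul, abs_of_nonneg h0]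
    _ ≤ √(x ^ 2 + y ^ 2) * M := by gcongr; exact hunit φ
    _ = _ := mul_comm _ _

/-! ### Positive definite operators and their norms. -/

section LinearAlgebra

variable {V : Type*} [NormedAddCommGroup V] [NormedSpace ℝ V]

/-- Symmetric positive definite operators `V → V*`. -/
structure IsSPD (B : V →L[ℝ] StrongDual ℝ V) : Prop where
  symm : ∀ u v, B u v = B v u
  pos : ∀ v, v ≠ 0 → 0 < B v v

namespace IsSPD

variable {B : V →L[ℝ] StrongDual ℝ V}

theorem nonneg (hB : IsSPD B) (v : V) : 0 ≤ B v v := by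
  rcases eq_or_ne v 0 with rfl | h
  · simp
  · exact (hB.pos v h).le

theorem sq_opNorm (hB : IsSPD B) (v : V) : opNorm B v ^ 2 = B v v :=
  Real.sq_sqrt (hB.nonneg v)

theorem opNorm_pos (hB : IsSPD B) {v : V} (hv : v ≠ 0) : 0 < opNorm B v :=
  Real.sqrt_pos.2 (hB.pos v hv)

theorem opNorm_smul (B : V →L[ℝ] StrongDual ℝ V) (t : ℝ) (v : V) :
    opNorm B (t • v) = |t| * opNorm B v := by
  simp only [opNorm, map_smul, smul_apply, smul_eq_mul]
  rw [← mul_assoc, Real.sqrt_mul (mul_self_nonneg t), Real.sqrt_mul_self_eq_abs]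

theorem opNorm_neg (B : V →L[ℝ] StrongDual ℝ V) (v : V) : opNorm B (-v) = opNorm B v := by
  simp [opNorm]

theorem opNorm_zero (B : V →L[ℝ] StrongDual ℝ V) : opNorm B 0 = 0 := by
  simp [opNorm]

theorem opNorm_nonneg (B : V →L[ℝ] StrongDual ℝ V) (v : V) : 0 ≤ opNorm B v := Real.sqrt_nonneg _

/-- Cauchy–Schwarz. -/
theorem abs_apply_le (hB : IsSPD B) (u v : V) : |B u v| ≤ opNorm B u * opNorm B v := by
  have key : ∀ t : ℝ, 0 ≤ B v v * (t * t) + (2 * B u v) * t + B u u := by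
    intro t
    have h := hB.nonneg (u + t • v)
    simp only [map_add, map_smul, add_apply, smul_apply,
      smul_eq_mul, hB.symm v u] at h
    linarith
  have h := discrim_le_zero key
  rw [discrim] at h
  apply abs_le_of_sq_le_sq _ (mul_nonneg (opNorm_nonneg _ _) (opNorm_nonneg _ _))
  rw [mul_pow, hB.sq_opNorm, hB.sq_opNorm]
  linarith

theorem opNorm_add_le (hB : IsSPD B) (u v : V) : opNorm B (u + v) ≤ opNorm B u + opNorm B v := by
  apply le_of_sq_le_sq _ (add_nonneg (opNorm_nonneg _ _) (opNorm_nonneg _ _))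
  have h := (abs_le.1 (hB.abs_apply_le u v)).2
  rw [add_sq, hB.sq_opNorm, hB.sq_opNorm, hB.sq_opNorm]
  simp only [map_add, add_apply, hB.symm v u]
  linarith

/-- Self-concordance only controls the diagonal `T h h h`. For a unit vector `u`, write `v = a u + c
k` with `k` a unit vector `B`-orthogonal to `u`. On the plane of `u` and `k`, `T` is a binary cubic
form, `T v u u = a T(u,u,u) + c T(k,u,u)` is the expression bounded by `cubic_form_bound`, and `√(a²
+ c²)` is the norm of `v`. -/
theorem abs_trilinear_le (hB : IsSPD B) (T : V →L[ℝ] V →L[ℝ] V →L[ℝ] ℝ)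
    (h12 : ∀ u v w, T u v w = T v u w) (h23 : ∀ u v w, T u v w = T u w v) {M : ℝ}
    (hT : ∀ h, |T h h h| ≤ M * opNorm B h ^ 3) (v u : V) :
    |T v u u| ≤ M * opNorm B v * B u u := by
  rcases eq_or_ne u 0 with rfl | hu
  · simp
  have hunit : ∀ u, B u u = 1 → |T v u u| ≤ M * opNorm B v := by
    intro u hu
    have hone : ∀ h, B h h = 1 → |T h h h| ≤ M := by
      intro h hh
      simpa [opNorm, hh] using hT h
    set a := B u v with ha
    set e := v - a • u with he
    have hv : v = a • u + e := by simp [he]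
    have hue : B u e = 0 := by simp [he, hu, ha]
    have heu : B e u = 0 := by rw [hB.symm, hue]
    have hvv : B v v = a ^ 2 + B e e := by
      rw [hv]; simp [hu, hue, heu]; ring
    rcases eq_or_ne e 0 with h0 | h0
    · have : |T v u u| = |a| * |T u u u| := by rw [hv, h0]; simp [abs_mul]
      have h2 : opNorm B v = |a| := by
        rw [opNorm, hvv, h0]; simp [Real.sqrt_sq_eq_abs]
      rw [this, h2, mul_comm M]
      gcongr
      exact hone u hu
    · have hc := hB.opNorm_pos h0
      set c := opNorm B e with hcdef
      have hcc : B e e = c ^ 2 := (hB.sq_opNorm e).symm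
      set k := c⁻¹ • e with hk
      have hek : e = c • k := by rw [hk, smul_inv_smul₀ hc.ne']
      have hkk : B k k = 1 := by
        simp only [hk, map_smul, smul_apply, smul_eq_mul, hcc]
        field_simp
      have huk : B u k = 0 := by simp [hk, hue]
      have hku : B k u = 0 := by simp [hk, heu]
      have := cubic_form_bound (T u u u) (T k u u) (T k k u) (T k k k) M (by
        intro x y hxy
        have h := hone (x • u + y • k) (by simp [hu, hkk, huk, hku]; linarith)
        convert h using 2
        simp only [map_add, map_smul, add_apply,
          smul_apply, smul_eq_mul]
        have e1 : T u u k = T k u u := by rw [h23, h12]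
        have e2 : T u k u = T k u u := h12 _ _ _
        have e3 : T u k k = T k k u := by rw [h12, h23]
        have e4 : T k u k = T k k u := h23 _ _ _
        rw [e1, e2, e3, e4]; ring) a c
      convert this using 2
      · rw [hv, hek]
        simp only [map_add, map_smul, add_apply,
          smul_apply, smul_eq_mul]
        ring
      · rw [opNorm, hvv, hcc]
  have hn := hB.opNorm_pos hu
  set n := opNorm B u with hndef
  have h1 := hunit (n⁻¹ • u) (by
    simp only [map_smul, smul_apply, smul_eq_mul, ← hB.sq_opNorm u, ← hndef]
    field_simp)
  simp only [map_smul, smul_apply, smul_eq_mul, ← mul_assoc, abs_mul] at h1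
  rw [abs_of_pos (inv_pos.2 hn)] at h1
  rw [← hB.sq_opNorm u, ← hndef]
  calc |T v u u| = (n⁻¹ * n⁻¹ * |T v u u|) * n ^ 2 := by field_simp
    _ ≤ M * opNorm B v * n ^ 2 := by gcongr

/-- A symmetric bilinear form dominated by `ε B` on the diagonal is dominated everywhere. -/
theorem abs_bilinear_le (hB : IsSPD B) (D : V →L[ℝ] StrongDual ℝ V) (hD : ∀ u v, D u v = D v u)
    {ε : ℝ} (hε : ∀ u, |D u u| ≤ ε * B u u) (u v : V) :
    |D u v| ≤ ε * (opNorm B u * opNorm B v) := by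
  rcases eq_or_ne u 0 with rfl | hu
  · simp [opNorm]
  rcases eq_or_ne v 0 with rfl | hv
  · simp [opNorm]
  -- Polarization: `4 D(u,v) = D(u+v,u+v) - D(u-v,u-v)`, while the values of `B` at `u+v` and `u-v`
  -- sum to 4.
  have hunit : ∀ u v, B u u = 1 → B v v = 1 → |D u v| ≤ ε := by
    intro u v hu hv
    have h1 := abs_le.1 (hε (u + v))
    have h2 := abs_le.1 (hε (u - v))
    simp only [map_add, map_sub, add_apply, sub_apply,
      hB.symm v u, hD v u, hu, hv] at h1 h2
    rw [abs_le]
    constructor <;> linarith [h1.1, h1.2, h2.1, h2.2]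
  have hm := hB.opNorm_pos hu
  have hn := hB.opNorm_pos hv
  set m := opNorm B u with hmdef
  set n := opNorm B v with hndef
  have h1 := hunit (m⁻¹ • u) (n⁻¹ • v) (by
    simp only [map_smul, smul_apply, smul_eq_mul, ← hB.sq_opNorm u, ← hmdef]
    field_simp) (by
    simp only [map_smul, smul_apply, smul_eq_mul, ← hB.sq_opNorm v, ← hndef]
    field_simp)
  simp only [map_smul, smul_apply, smul_eq_mul, ← mul_assoc, abs_mul] at h1
  rw [abs_of_pos (inv_pos.2 hn), abs_of_pos (inv_pos.2 hm)] at h1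
  calc |D u v| = (n⁻¹ * m⁻¹ * |D u v|) * (m * n) := by field_simp
    _ ≤ ε * (m * n) := by gcongr

section Inverse

variable [FiniteDimensional ℝ V]

theorem exists_equiv (hB : IsSPD B) :
    ∃ e : V ≃L[ℝ] StrongDual ℝ V, (e : V →L[ℝ] StrongDual ℝ V) = B := by
  have hinj : Function.Injective B.toLinearMap := by
    rw [← LinearMap.ker_eq_bot, LinearMap.ker_eq_bot']
    intro v hv
    by_contra h
    have := hB.pos v h
    have hv' : B v = 0 := hv
    simp [hv'] at this
  have hfin : Module.finrank ℝ V = Module.finrank ℝ (StrongDual ℝ V) := by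
    rw [← (LinearMap.toContinuousLinearMap : (V →ₗ[ℝ] ℝ) ≃ₗ[ℝ] (V →L[ℝ] ℝ)).finrank_eq]
    exact Subspace.dual_finrank_eq.symm
  refine ⟨(LinearEquiv.ofInjectiveOfFinrankEq B.toLinearMap hinj hfin).toContinuousLinearEquiv, ?_⟩
  ext x g; rfl

theorem inverse_apply (hB : IsSPD B) (v : V) : B.inverse (B v) = v := by
  obtain ⟨e, rfl⟩ := hB.exists_equiv
  simp

theorem apply_inverse (hB : IsSPD B) (s : StrongDual ℝ V) : B (B.inverse s) = s := by
  obtain ⟨e, rfl⟩ := hB.exists_equiv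
  simp

theorem inverse_symm (hB : IsSPD B) (s t : StrongDual ℝ V) : s (B.inverse t) = t (B.inverse s) := by
  conv_lhs => rw [← hB.apply_inverse s]
  conv_rhs => rw [← hB.apply_inverse t]
  exact hB.symm _ _

theorem inverse_pos (hB : IsSPD B) {s : StrongDual ℝ V} (hs : s ≠ 0) : 0 < s (B.inverse s) := by
  have h : B.inverse s ≠ 0 := by
    intro h
    apply hs
    rw [← hB.apply_inverse s, h, map_zero]
  have := hB.pos _ h
  rwa [hB.apply_inverse] at this

theorem inverse_nonneg (hB : IsSPD B) (s : StrongDual ℝ V) : 0 ≤ s (B.inverse s) := by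
  have := hB.nonneg (B.inverse s)
  rwa [hB.apply_inverse] at this

theorem opNorm_inverse (hB : IsSPD B) (s : StrongDual ℝ V) :
    opNorm B (B.inverse s) = opDualNorm B s := by
  rw [opNorm, opDualNorm, hB.apply_inverse]

theorem sq_opDualNorm (hB : IsSPD B) (s : StrongDual ℝ V) :
    opDualNorm B s ^ 2 = s (B.inverse s) :=
  Real.sq_sqrt (hB.inverse_nonneg s)

theorem abs_dual_apply_le (hB : IsSPD B) (s : StrongDual ℝ V) (v : V) :
    |s v| ≤ opDualNorm B s * opNorm B v := by
  have := hB.abs_apply_le (B.inverse s) v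
  rwa [hB.apply_inverse, hB.opNorm_inverse] at this

theorem dual_apply_le (hB : IsSPD B) (s : StrongDual ℝ V) (v : V) :
    s v ≤ opDualNorm B s * opNorm B v :=
  (abs_le.1 (hB.abs_dual_apply_le s v)).2

theorem neg_le_dual_apply (hB : IsSPD B) (s : StrongDual ℝ V) (v : V) :
    -(opDualNorm B s * opNorm B v) ≤ s v :=
  (abs_le.1 (hB.abs_dual_apply_le s v)).1

end Inverse

end IsSPD

end LinearAlgebra

end ConicIPM

/-! ### Consequences of self-concordance, for the barrier and its dual alike. -/

namespace ConicIPM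

section SelfConcordance

variable {V : Type*} [NormedAddCommGroup V] [NormedSpace ℝ V]

/-- On `U`, the map `g` is the gradient of a nondegenerate self-concordant function with
Hessian `H`. -/
structure IsSelfConcordantGrad (U : Set V) (g : V → StrongDual ℝ V)
    (H : V → V →L[ℝ] StrongDual ℝ V) : Prop where
  convex : Convex ℝ U
  hasFDerivAt : ∀ x ∈ U, HasFDerivAt g (H x) x
  spd : ∀ x ∈ U, IsSPD (H x)
  exists_deriv : ∀ x ∈ U, ∀ v u, ∃ d, HasDerivAt (fun t : ℝ => H (x + t • v) u u) d 0 ∧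
    |d| ≤ 2 * opNorm (H x) v * H x u u

namespace IsSelfConcordantGrad

variable {U : Set V} {g : V → StrongDual ℝ V} {H : V → V →L[ℝ] StrongDual ℝ V}

theorem exists_deriv_line (h : IsSelfConcordantGrad U g H) {x v : V} {t : ℝ} (ht : x + t • v ∈ U)
    (u : V) : ∃ d, HasDerivAt (fun t : ℝ => H (x + t • v) u u) d t ∧
      |d| ≤ 2 * opNorm (H (x + t • v)) v * H (x + t • v) u u := by
  obtain ⟨d, hd, hd'⟩ := h.exists_deriv _ ht v u
  refine ⟨d, ?_, hd'⟩
  have h1 : HasDerivAt (fun τ : ℝ => τ - t) 1 t := (hasDerivAt_id t).sub_const t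
  have h2 := HasDerivAt.comp t (h₂ := fun t' : ℝ => H (x + t • v + t' • v) u u) (h := fun τ => τ - t)
    (by simpa using hd) h1
  rw [mul_one] at h2
  refine h2.congr_of_eventuallyEq (.of_forall fun τ => ?_)
  simp only [Function.comp]
  rw [show x + t • v + (τ - t) • v = x + τ • v by module]

theorem hasDerivAt_grad_line (h : IsSelfConcordantGrad U g H) {x v : V} {t : ℝ}
    (ht : x + t • v ∈ U) :
    HasDerivAt (fun t : ℝ => g (x + t • v) v) (H (x + t • v) v v) t := by
  have h1 : HasDerivAt (fun τ : ℝ => x + τ • v) v t := by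
    simpa using ((hasDerivAt_id t).smul_const v).const_add x
  have h2 := (h.hasFDerivAt _ ht).comp_hasDerivAt t h1
  simpa using h2.clm_apply (hasDerivAt_const t v)

/-- The reciprocal of the local norm of the direction is 1-Lipschitz along a line. -/
theorem abs_inv_opNorm_sub_le (h : IsSelfConcordantGrad U g H) {x v : V} (hv : v ≠ 0) {T : ℝ}
    (hT : 0 ≤ T) (hU : ∀ t ∈ Icc 0 T, x + t • v ∈ U) :
    |(opNorm (H (x + T • v)) v)⁻¹ - (opNorm (H x) v)⁻¹| ≤ T := by
  have hd : ∀ t ∈ Icc 0 T, ∃ d, HasDerivAt (fun t : ℝ => (opNorm (H (x + t • v)) v)⁻¹) d t ∧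
      ‖d‖ ≤ 1 := by
    intro t ht
    obtain ⟨d, hd, hd'⟩ := h.exists_deriv_line (hU t ht) v
    have hpos := (h.spd _ (hU t ht)).pos v hv
    have hs := Real.sqrt_pos.2 hpos
    have h1 := (hd.sqrt hpos.ne').inv hs.ne'
    -- With `φ(t) = H(x + t v) v v`, the derivative of `φ^(-1/2)` is `-φ'/(2φ^(3/2))`, and
    -- self-concordance reads `|φ'| ≤ 2φ^(3/2)`.
    refine ⟨_, h1, ?_⟩
    rw [Real.norm_eq_abs, abs_div, abs_neg, abs_div]
    change |d| ≤ 2 * √(H (x + t • v) v v) * H (x + t • v) v v at hd'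
    rw [Real.sq_sqrt hpos.le, abs_of_pos (by positivity : 0 < 2 * √(H (x + t • v) v v)),
      abs_of_pos hpos, div_div, div_le_one (by positivity)]
    exact hd'
  choose! d hd using hd
  have := norm_image_sub_le_of_norm_deriv_le_segment'
    (f := fun t : ℝ => (opNorm (H (x + t • v)) v)⁻¹) (f' := d) (C := 1) (a := 0) (b := T)
    (fun t ht => (hd t ht).1.hasDerivWithinAt) (fun t ht => (hd t (Ico_subset_Icc_self ht)).2) T
    ⟨hT, le_rfl⟩
  simpa using this

theorem le_opNorm_line (h : IsSelfConcordantGrad U g H) {x v : V} (hv : v ≠ 0) {T : ℝ}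
    (hT : 0 ≤ T) (hU : ∀ t ∈ Icc 0 T, x + t • v ∈ U) :
    opNorm (H x) v / (1 + opNorm (H x) v * T) ≤ opNorm (H (x + T • v)) v := by
  have h1 := (abs_le.1 (h.abs_inv_opNorm_sub_le hv hT hU)).2
  have hx : 0 < opNorm (H x) v := (h.spd x (by simpa using hU 0 ⟨le_rfl, hT⟩)).opNorm_pos hv
  have hy := (h.spd _ (hU T ⟨hT, le_rfl⟩)).opNorm_pos hv
  generalize opNorm (H x) v = r at *
  generalize opNorm (H (x + T • v)) v = n at *
  have h2 : n⁻¹ ≤ (r / (1 + r * T))⁻¹ := by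
    have : (r / (1 + r * T))⁻¹ = r⁻¹ + T := by field_simp
    linarith
  exact (inv_le_inv₀ hy (by positivity)).1 h2

theorem opNorm_line_le (h : IsSelfConcordantGrad U g H) {x v : V} (hv : v ≠ 0) {T : ℝ}
    (hT : 0 ≤ T) (hU : ∀ t ∈ Icc 0 T, x + t • v ∈ U) (hr : opNorm (H x) v * T < 1) :
    opNorm (H (x + T • v)) v ≤ opNorm (H x) v / (1 - opNorm (H x) v * T) := by
  have h1 := (abs_le.1 (h.abs_inv_opNorm_sub_le hv hT hU)).1
  have hx : 0 < opNorm (H x) v := (h.spd x (by simpa using hU 0 ⟨le_rfl, hT⟩)).opNorm_pos hv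
  have hy := (h.spd _ (hU T ⟨hT, le_rfl⟩)).opNorm_pos hv
  generalize opNorm (H x) v = r at *
  generalize opNorm (H (x + T • v)) v = n at *
  have hr' : 0 < 1 - r * T := by linarith
  have h2 : (r / (1 - r * T))⁻¹ ≤ n⁻¹ := by
    have : (r / (1 - r * T))⁻¹ = r⁻¹ - T := by field_simp
    linarith
  exact (inv_le_inv₀ (by positivity) hy).1 h2

/-- The slope of `⟨g, v⟩` along the line is the squared local norm of `v`, at least `r²/(1+rt)²` by
`le_opNorm_line`; the left side is the integral of this bound. -/
theorem le_grad_sub_line (h : IsSelfConcordantGrad U g H) {x v : V} (hv : v ≠ 0) {T : ℝ}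
    (hT : 0 ≤ T) (hU : ∀ t ∈ Icc 0 T, x + t • v ∈ U) :
    opNorm (H x) v ^ 2 * T / (1 + opNorm (H x) v * T) ≤ g (x + T • v) v - g x v := by
  have hx : 0 < opNorm (H x) v := (h.spd x (by simpa using hU 0 ⟨le_rfl, hT⟩)).opNorm_pos hv
  set r := opNorm (H x) v with hr
  have hd : ∀ t ∈ Icc 0 T, HasDerivAt (fun t : ℝ => g (x + t • v) v - r ^ 2 * t / (1 + r * t))
      (H (x + t • v) v v - (r / (1 + r * t)) ^ 2) t := by
    intro t ht
    have h0 : (1 + r * t) ≠ 0 := by have := mul_nonneg hx.le ht.1; positivity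
    have h1 := h.hasDerivAt_grad_line (hU t ht)
    have h2 : HasDerivAt (fun t : ℝ => r ^ 2 * t) (r ^ 2) t := by
      simpa using (hasDerivAt_id t).const_mul (r ^ 2)
    have h3 : HasDerivAt (fun t : ℝ => 1 + r * t) r t := by
      simpa using ((hasDerivAt_id t).const_mul r).const_add 1
    refine (h1.sub (h2.div h3 h0)).congr_deriv ?_
    field_simp
    ring
  have hmono := monotoneOn_of_hasDerivWithinAt_nonneg (convex_Icc 0 T)
    (fun t ht => (hd t ht).continuousAt.continuousWithinAt)
    (fun t ht => (hd t (interior_subset ht)).hasDerivWithinAt)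
    (by
      intro t ht
      have ht' := interior_subset ht
      have h1 := h.le_opNorm_line hv ht'.1 (fun τ hτ => hU τ ⟨hτ.1, hτ.2.trans ht'.2⟩)
      have h2 := (h.spd _ (hU t ht')).sq_opNorm v
      rw [← hr] at h1
      have h3 : 0 ≤ r / (1 + r * t) := by have := mul_nonneg hx.le ht'.1; positivity
      rw [← h2, sub_nonneg]
      gcongr)
  have := hmono ⟨le_rfl, hT⟩ ⟨hT, le_rfl⟩ hT
  simp only [zero_smul, add_zero, mul_zero, zero_div, sub_zero] at this
  linarith

theorem segment_mem (h : IsSelfConcordantGrad U g H) {x y : V} (hx : x ∈ U) (hy : y ∈ U) :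
    ∀ t ∈ Icc (0 : ℝ) 1, x + t • (y - x) ∈ U :=
  fun _ ht => h.convex.add_smul_sub_mem hx hy ht

theorem le_grad_sub (h : IsSelfConcordantGrad U g H) {x y : V} (hx : x ∈ U) (hy : y ∈ U) :
    opNorm (H x) (y - x) ^ 2 / (1 + opNorm (H x) (y - x)) ≤ g y (y - x) - g x (y - x) := by
  rcases eq_or_ne (y - x) 0 with h0 | h0
  · simp [h0, IsSPD.opNorm_zero]
  · simpa using h.le_grad_sub_line h0 zero_le_one (h.segment_mem hx hy)

/-- The local norm of a recession direction along which the function decreases. -/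
theorem opNorm_le_of_recession (h : IsSelfConcordantGrad U g H) {x u : V}
    (hU : ∀ t : ℝ, 0 ≤ t → x + t • u ∈ U) (hg : ∀ t : ℝ, 0 ≤ t → g (x + t • u) u ≤ 0) :
    opNorm (H x) u ≤ -(g x u) := by
  rcases eq_or_ne u 0 with h0 | h0
  · simp [h0, IsSPD.opNorm_zero]
  have hr : 0 < opNorm (H x) u := (h.spd x (by simpa using hU 0 le_rfl)).opNorm_pos h0
  have key : ∀ T : ℝ, 0 ≤ T →
      opNorm (H x) u ^ 2 * T ≤ -(g x u) * (1 + opNorm (H x) u * T) := by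
    intro T hT
    have h1 := h.le_grad_sub_line h0 hT (fun t ht => hU t ht.1)
    have h2 := hg T hT
    rw [div_le_iff₀ (by positivity)] at h1
    refine h1.trans (mul_le_mul_of_nonneg_right (by linarith) (by positivity))
  generalize opNorm (H x) u = r at *
  generalize -(g x u) = a at *
  by_contra hlt
  push Not at hlt
  have ha : 0 ≤ a := by
    have := key 1 zero_le_one
    by_contra hneg
    push Not at hneg
    have h3 := mul_neg_of_neg_of_pos hneg (by positivity : 0 < 1 + r * 1)
    nlinarith
  have hpos : 0 < r * (r - a) := mul_pos hr (by linarith)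
  -- If `r > a`, then `r² T ≤ a (1 + r T)` fails for large `T`; this `T` makes `r (r - a) T = a + 1
  -- > a`.
  have := key ((a + 1) / (r * (r - a))) (by positivity)
  have h4 : r * (r - a) * ((a + 1) / (r * (r - a))) = a + 1 := by
    field_simp
  nlinarith

/-- Comparison of Hessians at points close in the local norm. -/
theorem hess_le (h : IsSelfConcordantGrad U g H) {x y : V} (hx : x ∈ U) (hy : y ∈ U)
    (hr : opNorm (H x) (y - x) < 1) (u : V) :
    (1 - opNorm (H x) (y - x)) ^ 2 * H y u u ≤ H x u u ∧
      (1 - opNorm (H x) (y - x)) ^ 2 * H x u u ≤ H y u u := by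
  rcases eq_or_ne (y - x) 0 with h0 | h0
  · have : y = x := sub_eq_zero.1 h0
    simp [this, IsSPD.opNorm_zero]
  set v := y - x with hv
  have hU := h.segment_mem hx hy
  rw [← hv] at hU
  have hr0 := IsSPD.opNorm_nonneg (H x) v
  set r := opNorm (H x) v with hrdef
  have hpos : ∀ t ∈ Icc (0 : ℝ) 1, 0 < 1 - r * t := by
    intro t ht
    have := mul_le_mul_of_nonneg_left ht.2 hr0
    linarith
  have hd : ∀ t ∈ Icc (0 : ℝ) 1, ∃ d, HasDerivAt (fun t : ℝ => H (x + t • v) u u) d t ∧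
      |d| * (1 - r * t) ≤ 2 * r * H (x + t • v) u u := by
    intro t ht
    obtain ⟨d, hd, hd'⟩ := h.exists_deriv_line (hU t ht) u
    refine ⟨d, hd, ?_⟩
    have h1 := h.opNorm_line_le h0 ht.1 (fun τ hτ => hU τ ⟨hτ.1, hτ.2.trans ht.2⟩)
      (by have := hpos t ht; linarith)
    rw [← hrdef, le_div_iff₀ (hpos t ht)] at h1
    have h2 := (h.spd _ (hU t ht)).nonneg u
    calc |d| * (1 - r * t) ≤ 2 * opNorm (H (x + t • v)) v * H (x + t • v) u u * (1 - r * t) := by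
          have := (hpos t ht).le
          gcongr
      _ = 2 * (opNorm (H (x + t • v)) v * (1 - r * t)) * H (x + t • v) u u := by ring
      _ ≤ 2 * r * H (x + t • v) u u := by gcongr
  choose! d hd using hd
  have hlin : ∀ t, HasDerivAt (fun t : ℝ => (1 - r * t) ^ 2) (-(2 * r * (1 - r * t))) t := by
    intro t
    have h3 : HasDerivAt (fun t : ℝ => 1 - r * t) (-r) t := by
      simpa using ((hasDerivAt_id t).const_mul r).const_sub 1
    refine (h3.pow 2).congr_deriv ?_
    simp; ring
  have hy' : x + (1 : ℝ) • v = y := by rw [hv]; module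
  -- The logarithmic derivative of `H(x + t v) u u` is at most `2r/(1 - rt)` in absolute value, so
  -- multiplying by `(1 - rt)²` gives a decreasing function and dividing by it an increasing one.
  constructor
  · have hd1 : ∀ t ∈ Icc (0 : ℝ) 1, HasDerivAt (fun t : ℝ => (1 - r * t) ^ 2 * H (x + t • v) u u) _ t :=
      fun t ht => (hlin t).mul (hd t ht).1
    have := antitoneOn_of_hasDerivWithinAt_nonpos (convex_Icc 0 1)
      (fun t ht => (hd1 t ht).continuousAt.continuousWithinAt)
      (fun t ht => (hd1 t (interior_subset ht)).hasDerivWithinAt)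
      (by
        intro t ht
        have ht' := interior_subset ht
        have h1 := (hd t ht').2
        have h2 := hpos t ht'
        have h3 := (abs_le.1 le_rfl : -|d t| ≤ d t ∧ d t ≤ |d t|).2
        have h4 := mul_le_mul_of_nonneg_right h3 h2.le
        nlinarith [mul_le_mul_of_nonneg_right (h4.trans h1) h2.le])
    have := this ⟨le_rfl, zero_le_one⟩ ⟨zero_le_one, le_rfl⟩ zero_le_one
    simpa only [hy', zero_smul, add_zero, mul_zero, sub_zero, mul_one, one_pow, one_mul] using this
  · have hd1 : ∀ t ∈ Icc (0 : ℝ) 1, HasDerivAt (fun t : ℝ => H (x + t • v) u u / (1 - r * t) ^ 2) _ t :=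
      fun t ht => (hd t ht).1.div (hlin t) (pow_pos (hpos t ht) 2).ne'
    have := monotoneOn_of_hasDerivWithinAt_nonneg (convex_Icc 0 1)
      (fun t ht => (hd1 t ht).continuousAt.continuousWithinAt)
      (fun t ht => (hd1 t (interior_subset ht)).hasDerivWithinAt)
      (by
        intro t ht
        have ht' := interior_subset ht
        have h1 := (hd t ht').2
        have h2 := hpos t ht'
        have h3 := (abs_le.1 le_rfl : -|d t| ≤ d t ∧ d t ≤ |d t|).1
        have h4 := mul_le_mul_of_nonneg_right h3 h2.le
        apply div_nonneg _ (by positivity)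
        nlinarith [mul_le_mul_of_nonneg_right
          (by linarith : 0 ≤ d t * (1 - r * t) + 2 * r * H (x + t • v) u u) h2.le])
    have := this ⟨le_rfl, zero_le_one⟩ ⟨zero_le_one, le_rfl⟩ zero_le_one
    simp only [hy', zero_smul, add_zero, mul_zero, sub_zero, mul_one] at this
    rw [le_div_iff₀ (by have : 0 < 1 - r := by linarith
                        positivity)] at this
    linarith

end IsSelfConcordantGrad

end SelfConcordance

end ConicIPM

/-! ### Regular cones and their duals. -/

namespace ConicIPM

section Cones

variable {V : Type*} [NormedAddCommGroup V] [NormedSpace ℝ V] {K : ConvexCone ℝ V}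

theorem IsRegularCone.zero_mem (hK : IsRegularCone K) : (0 : V) ∈ K := by
  obtain ⟨x, hx⟩ := hK.nonempty_interior
  have h1 : Tendsto (fun t : ℝ => t • x) (𝓝[>] 0) (𝓝 ((0 : ℝ) • x)) :=
    ((continuous_id.smul continuous_const).tendsto 0).mono_left nhdsWithin_le_nhds
  rw [zero_smul] at h1
  exact hK.isClosed.mem_of_tendsto h1
    (eventually_nhdsWithin_of_forall fun t ht => K.smul_mem ht (interior_subset hx))

theorem IsRegularCone.smul_mem (hK : IsRegularCone K) {t : ℝ} (ht : 0 ≤ t) {x : V} (hx : x ∈ K) :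
    t • x ∈ K := by
  rcases ht.eq_or_lt with rfl | h
  · simpa using hK.zero_mem
  · exact K.smul_mem h hx

open scoped Pointwise in
theorem smul_mem_interior {t : ℝ} (ht : 0 < t) {x : V} (hx : x ∈ interior (K : Set V)) :
    t • x ∈ interior (K : Set V) := by
  have h : t • interior (K : Set V) ⊆ interior (K : Set V) := by
    apply interior_maximal _ (isOpen_interior.smul₀ ht.ne')
    rintro _ ⟨y, hy, rfl⟩
    exact K.smul_mem ht (interior_subset hy)
  exact h (smul_mem_smul_set hx)

theorem add_mem_interior {x u : V} (hx : x ∈ interior (K : Set V)) (hu : u ∈ K) :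
    x + u ∈ interior (K : Set V) := by
  have h : (fun z => z + u) '' interior (K : Set V) ⊆ interior (K : Set V) := by
    apply interior_maximal _ ((Homeomorph.addRight u).isOpenMap _ isOpen_interior)
    rintro _ ⟨y, hy, rfl⟩
    exact K.add_mem (interior_subset hy) hu
  exact h ⟨x, hx, rfl⟩

/-- Bipolar theorem: a functional strictly separating `p` from `K` must be nonnegative on `K` by
scaling, yet it is negative at `p`. -/
theorem IsRegularCone.mem_of_dual (hK : IsRegularCone K) {p : V}
    (hp : ∀ s ∈ dualCone K, 0 ≤ s p) : p ∈ K := by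
  by_contra hpK
  obtain ⟨f, u, hfu, hf⟩ := geometric_hahn_banach_point_closed K.convex hK.isClosed hpK
  have hu : u < 0 := by simpa using hf 0 hK.zero_mem
  have hfK : f ∈ dualCone K := by
    intro x hx
    by_contra hneg
    push Not at hneg
    have h1 := hf ((u / f x) • x) (K.smul_mem (div_pos_of_neg_of_neg hu hneg) hx)
    rw [map_smul, smul_eq_mul, div_mul_cancel₀ _ hneg.ne] at h1
    exact lt_irrefl _ h1
  linarith [hp f hfK]

theorem convex_dualCone : Convex ℝ (dualCone K) := by
  intro s hs t ht a b ha hb _ x hx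
  simp only [add_apply, smul_apply, smul_eq_mul]
  have := hs x hx
  have := ht x hx
  positivity

theorem add_mem_dualCone {s t : StrongDual ℝ V} (hs : s ∈ dualCone K) (ht : t ∈ dualCone K) :
    s + t ∈ dualCone K :=
  fun x hx => add_nonneg (hs x hx) (ht x hx)

theorem smul_mem_dualCone {s : StrongDual ℝ V} {t : ℝ} (ht : 0 ≤ t) (hs : s ∈ dualCone K) :
    t • s ∈ dualCone K :=
  fun x hx => mul_nonneg ht (hs x hx)

theorem add_mem_interior_dualCone {s t : StrongDual ℝ V} (hs : s ∈ interior (dualCone K))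
    (ht : t ∈ dualCone K) : s + t ∈ interior (dualCone K) := by
  have h : (fun z => z + t) '' interior (dualCone K) ⊆ interior (dualCone K) := by
    apply interior_maximal _ ((Homeomorph.addRight t).isOpenMap _ isOpen_interior)
    rintro _ ⟨y, hy, rfl⟩
    exact add_mem_dualCone (interior_subset hy) ht
  exact h ⟨s, hs, rfl⟩

open scoped Pointwise in
theorem smul_mem_interior_dualCone {s : StrongDual ℝ V} {t : ℝ} (ht : 0 < t)
    (hs : s ∈ interior (dualCone K)) : t • s ∈ interior (dualCone K) := by
  have h : t • interior (dualCone K) ⊆ interior (dualCone K) := by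
    apply interior_maximal _ (isOpen_interior.smul₀ ht.ne')
    rintro _ ⟨y, hy, rfl⟩
    exact smul_mem_dualCone ht.le (interior_subset hy)
  exact h (smul_mem_smul_set hs)

/-- An interior element of the dual cone dominates a multiple of the norm on the cone. -/
theorem exists_norm_le_of_mem_interior_dualCone {s : StrongDual ℝ V}
    (hs : s ∈ interior (dualCone K)) : ∃ c > 0, ∀ x ∈ K, c * ‖x‖ ≤ s x := by
  obtain ⟨ε, hε, hball⟩ := Metric.isOpen_iff.1 isOpen_interior s hs
  refine ⟨ε / 2, by positivity, fun x hx => ?_⟩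
  obtain ⟨g, hg, hgx⟩ := exists_dual_vector'' ℝ x
  have h1 : s - (ε / 2) • g ∈ dualCone K := by
    apply interior_subset
    apply hball
    rw [mem_ball_iff_norm, sub_sub_cancel_left, norm_neg, norm_smul, Real.norm_of_nonneg (by positivity)]
    nlinarith
  have h2 := h1 x hx
  simp only [sub_apply, smul_apply, smul_eq_mul, hgx] at h2
  simpa using h2

end Cones

/-! ### Normal barriers: homogeneity identities and nondegeneracy. -/

section NormalBarrier

variable {V : Type*} [NormedAddCommGroup V] [NormedSpace ℝ V]
  {K : ConvexCone ℝ V} {ν : ℝ} {F : V → ℝ}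

namespace IsNormalBarrier

theorem contDiffAt (hF : IsNormalBarrier K ν F) {x : V} (hx : x ∈ interior (K : Set V)) :
    ContDiffAt ℝ 3 F x :=
  hF.contDiffOn.contDiffAt (isOpen_interior.mem_nhds hx)

theorem contDiffAt_grad (hF : IsNormalBarrier K ν F) {x : V} (hx : x ∈ interior (K : Set V)) :
    ContDiffAt ℝ 2 (grad F) x :=
  (hF.contDiffAt hx).fderiv_right (by norm_num)

theorem contDiffAt_hess (hF : IsNormalBarrier K ν F) {x : V} (hx : x ∈ interior (K : Set V)) :
    ContDiffAt ℝ 1 (hess F) x :=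
  (hF.contDiffAt_grad hx).fderiv_right (by norm_num)

theorem hasFDerivAt (hF : IsNormalBarrier K ν F) {x : V} (hx : x ∈ interior (K : Set V)) :
    HasFDerivAt F (grad F x) x :=
  ((hF.contDiffAt hx).differentiableAt (by norm_num)).hasFDerivAt

theorem hasFDerivAt_grad (hF : IsNormalBarrier K ν F) {x : V} (hx : x ∈ interior (K : Set V)) :
    HasFDerivAt (grad F) (hess F x) x :=
  ((hF.contDiffAt_grad hx).differentiableAt (by norm_num)).hasFDerivAt

theorem hasFDerivAt_hess (hF : IsNormalBarrier K ν F) {x : V} (hx : x ∈ interior (K : Set V)) :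
    HasFDerivAt (hess F) (fderiv ℝ (hess F) x) x :=
  ((hF.contDiffAt_hess hx).differentiableAt (by norm_num)).hasFDerivAt

theorem hess_symm (hF : IsNormalBarrier K ν F) {x : V} (hx : x ∈ interior (K : Set V)) (u v : V) :
    hess F x u v = hess F x v u :=
  ((hF.contDiffAt hx).isSymmSndFDerivAt (by simp; norm_num)).eq u v

theorem third_symm_left (hF : IsNormalBarrier K ν F) {x : V} (hx : x ∈ interior (K : Set V))
    (u v w : V) : fderiv ℝ (hess F) x u v w = fderiv ℝ (hess F) x v u w :=
  DFunLike.congr_fun (((hF.contDiffAt_grad hx).isSymmSndFDerivAt (by simp)).eq u v) w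

theorem hasDerivAt_hess_line (hF : IsNormalBarrier K ν F) {x : V}
    (hx : x ∈ interior (K : Set V)) (v : V) :
    HasDerivAt (fun t : ℝ => hess F (x + t • v)) (fderiv ℝ (hess F) x v) 0 := by
  have h1 : HasDerivAt (fun τ : ℝ => x + τ • v) v 0 := by
    simpa using ((hasDerivAt_id (0 : ℝ)).smul_const v).const_add x
  exact HasFDerivAt.comp_hasDerivAt (f := fun τ : ℝ => x + τ • v) (l := hess F) 0
    (by simpa using hF.hasFDerivAt_hess hx) h1

theorem hasDerivAt_hess_apply (hF : IsNormalBarrier K ν F) {x : V}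
    (hx : x ∈ interior (K : Set V)) (v u w : V) :
    HasDerivAt (fun t : ℝ => hess F (x + t • v) u w) (fderiv ℝ (hess F) x v u w) 0 := by
  simpa using ((hF.hasDerivAt_hess_line hx v).clm_apply (hasDerivAt_const 0 u)).clm_apply
    (hasDerivAt_const 0 w)

theorem eventually_mem_line {U : Set V} (hU : IsOpen U) {x : V} (hx : x ∈ U) (v : V) :
    ∀ᶠ t : ℝ in 𝓝 0, x + t • v ∈ U := by
  have h : ContinuousAt (fun t : ℝ => x + t • v) 0 := by fun_prop
  exact h.eventually_mem (hU.mem_nhds (by simpa using hx))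

theorem third_symm_right (hF : IsNormalBarrier K ν F) {x : V} (hx : x ∈ interior (K : Set V))
    (u v w : V) : fderiv ℝ (hess F) x u v w = fderiv ℝ (hess F) x u w v := by
  refine (hF.hasDerivAt_hess_apply hx u v w).unique
    ((hF.hasDerivAt_hess_apply hx u w v).congr_of_eventuallyEq ?_)
  filter_upwards [eventually_mem_line isOpen_interior hx u] with t ht
  exact hF.hess_symm ht _ _

theorem iteratedFDeriv_three (x h : V) :
    iteratedFDeriv ℝ 3 F x (fun _ => h) = fderiv ℝ (hess F) x h h h := by
  rw [iteratedFDeriv_succ_apply_right, iteratedFDeriv_succ_apply_right]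
  rw [iteratedFDeriv_one_apply]
  rfl

theorem le_sub (hF : IsNormalBarrier K ν F) {x y : V} (hx : x ∈ interior (K : Set V))
    (hy : y ∈ interior (K : Set V)) : grad F x (y - x) ≤ F y - F x := by
  have hd : HasDerivAt (fun t : ℝ => F (x + t • (y - x))) (grad F x (y - x)) 0 := by
    have h1 : HasDerivAt (fun τ : ℝ => x + τ • (y - x)) (y - x) 0 := by
      simpa using ((hasDerivAt_id (0 : ℝ)).smul_const (y - x)).const_add x
    exact HasFDerivAt.comp_hasDerivAt (f := fun τ : ℝ => x + τ • (y - x)) (l := F) 0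
      (by simpa using hF.hasFDerivAt hx) h1
  have hconv : ConvexOn ℝ (Icc (0 : ℝ) 1) (fun t : ℝ => F (x + t • (y - x))) := by
    have h := hF.convexOn.comp_affineMap (AffineMap.lineMap x y)
    refine (h.subset ?_ (convex_Icc 0 1)).congr ?_
    · intro t ht
      exact hF.convexOn.1.lineMap_mem hx hy ht
    · intro t _
      simp [AffineMap.lineMap_apply, add_comm]
  have := hconv.le_slope_of_hasDerivAt (x := 0) (y := 1) (by simp) (by simp) zero_lt_one hd
  simpa [slope_def_field] using this

theorem grad_smul (hF : IsNormalBarrier K ν F) {x : V} (hx : x ∈ interior (K : Set V)) {τ : ℝ}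
    (hτ : 0 < τ) : grad F (τ • x) = τ⁻¹ • grad F x := by
  have h1 : HasFDerivAt (fun z => F (τ • z)) (τ • grad F (τ • x)) x := by
    have := HasFDerivAt.comp x (f := fun z : V => τ • z)
      (hF.hasFDerivAt (smul_mem_interior hτ hx)) ((hasFDerivAt_id x).const_smul τ)
    exact this.congr_fderiv (by ext u; simp)
  have h2 : HasFDerivAt (fun z => F (τ • z)) (grad F x) x := by
    refine ((hF.hasFDerivAt hx).sub_const (ν * Real.log τ)).congr_of_eventuallyEq ?_
    filter_upwards [isOpen_interior.mem_nhds hx] with z hz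
    exact hF.logHomogeneous z hz τ hτ
  rw [← h1.unique h2, inv_smul_smul₀ hτ.ne']

theorem hasDerivAt_smul (x : V) : HasDerivAt (fun τ : ℝ => τ • x) x 1 := by
  simpa using (hasDerivAt_id (1 : ℝ)).smul_const x

theorem grad_self (hF : IsNormalBarrier K ν F) {x : V} (hx : x ∈ interior (K : Set V)) :
    grad F x x = -ν := by
  have h1 : HasDerivAt (fun τ : ℝ => F (τ • x)) (grad F x x) 1 :=
    HasFDerivAt.comp_hasDerivAt (f := fun τ : ℝ => τ • x) (l := F) 1
      (by simpa using hF.hasFDerivAt hx) (hasDerivAt_smul x)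
  have h2 : HasDerivAt (fun τ : ℝ => F (τ • x)) (-ν) 1 := by
    have h3 : HasDerivAt (fun τ : ℝ => F x - ν * Real.log τ) (-ν) 1 := by
      simpa using ((Real.hasDerivAt_log one_ne_zero).const_mul ν).const_sub (F x)
    refine h3.congr_of_eventuallyEq ?_
    filter_upwards [lt_mem_nhds (zero_lt_one (α := ℝ))] with τ hτ
    exact hF.logHomogeneous x hx τ hτ
  exact h1.unique h2

theorem hess_self (hF : IsNormalBarrier K ν F) {x : V} (hx : x ∈ interior (K : Set V)) :
    hess F x x = -grad F x := by
  have h1 : HasDerivAt (fun τ : ℝ => grad F (τ • x)) (hess F x x) 1 :=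
    HasFDerivAt.comp_hasDerivAt (f := fun τ : ℝ => τ • x) (l := grad F) 1
      (by simpa using hF.hasFDerivAt_grad hx) (hasDerivAt_smul x)
  have h2 : HasDerivAt (fun τ : ℝ => grad F (τ • x)) (-grad F x) 1 := by
    have h3 : HasDerivAt (fun τ : ℝ => τ⁻¹ • grad F x) (-grad F x) 1 := by
      simpa using (hasDerivAt_inv (one_ne_zero (α := ℝ))).smul_const (grad F x)
    refine h3.congr_of_eventuallyEq ?_
    filter_upwards [lt_mem_nhds (zero_lt_one (α := ℝ))] with τ hτ
    exact hF.grad_smul hx hτ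
  exact h1.unique h2

theorem hess_nonneg (hF : IsNormalBarrier K ν F) {x : V} (hx : x ∈ interior (K : Set V)) (h : V) :
    0 ≤ hess F x h h := by
  have h1 : HasDerivAt (fun τ : ℝ => x + τ • h) h 0 := by
    simpa using ((hasDerivAt_id (0 : ℝ)).smul_const h).const_add x
  have h2 : HasDerivAt (fun t : ℝ => grad F (x + t • h) h) (hess F x h h) 0 := by
    simpa using (HasFDerivAt.comp_hasDerivAt (f := fun τ : ℝ => x + τ • h) (l := grad F) 0
      (by simpa using hF.hasFDerivAt_grad hx) h1).clm_apply (hasDerivAt_const 0 h)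
  have h3 := (hasDerivAt_iff_tendsto_slope.1 h2).mono_left
    (nhdsWithin_mono 0 (fun t (ht : 0 < t) => ht.ne') : 𝓝[>] (0 : ℝ) ≤ _)
  refine ge_of_tendsto h3 ?_
  filter_upwards [self_mem_nhdsWithin,
    (eventually_mem_line isOpen_interior hx h).filter_mono nhdsWithin_le_nhds] with t ht htI
  have ht' : (0 : ℝ) < t := ht
  have e1 := hF.le_sub hx htI
  have e2 := hF.le_sub htI hx
  simp only [add_sub_cancel_left, map_smul, smul_eq_mul, sub_add_cancel_left, map_neg] at e1 e2
  simp only [slope_def_field, zero_smul, add_zero, sub_zero]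
  apply div_nonneg _ ht'.le
  have : 0 ≤ t * (grad F (x + t • h) h - grad F x h) := by linarith
  exact nonneg_of_mul_nonneg_right this ht'

theorem nu_nonneg (hF : IsNormalBarrier K ν F) {x : V} (hx : x ∈ interior (K : Set V)) :
    0 ≤ ν := by
  have h1 := hF.hess_nonneg hx x
  rw [hF.hess_self hx, neg_apply, hF.grad_self hx] at h1
  linarith

/-- A segment along which the barrier is degenerate at one end is degenerate throughout. -/
theorem hess_line_eq_zero (hF : IsNormalBarrier K ν F) {x h : V} {T : ℝ}
    (hU : ∀ t ∈ Icc 0 T, x + t • h ∈ interior (K : Set V)) (h0 : hess F x h h = 0) :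
    ∀ t ∈ Icc 0 T, hess F (x + t • h) h h = 0 := by
  have hd : ∀ t ∈ Icc 0 T, HasDerivAt (fun t : ℝ => hess F (x + t • h) h h)
      (fderiv ℝ (hess F) (x + t • h) h h h) t := by
    intro t ht
    have h1 : HasDerivAt (fun τ : ℝ => x + τ • h) h t := by
      simpa using ((hasDerivAt_id t).smul_const h).const_add x
    simpa using ((HasFDerivAt.comp_hasDerivAt (f := fun τ : ℝ => x + τ • h) (l := hess F) t
      (hF.hasFDerivAt_hess (hU t ht)) h1).clm_apply (hasDerivAt_const t h)).clm_apply
        (hasDerivAt_const t h)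
  have hc : ContinuousOn (fun t : ℝ => hess F (x + t • h) h h) (Icc 0 T) :=
    fun t ht => (hd t ht).continuousAt.continuousWithinAt
  obtain ⟨M, hM⟩ := isCompact_Icc.exists_bound_of_continuousOn hc
  -- Grönwall: where `φ ≤ M`, the bound `|φ'| ≤ 2φ^(3/2)` becomes the linear one `|φ'| ≤ 2√M φ`.
  refine eq_zero_of_abs_deriv_le_mul_abs_self_of_eq_zero_right (K := 2 * √M) hc
    (fun t ht => (hd t (Ico_subset_Icc_self ht)).hasDerivWithinAt) (by simpa using h0) ?_
  intro t ht
  have ht' := Ico_subset_Icc_self ht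
  have h1 := hF.selfConcordant _ (hU t ht') h
  have h2 := hF.hess_nonneg (hU t ht') h
  have h3 := hM t ht'
  rw [iteratedFDeriv_three] at h1
  rw [Real.norm_eq_abs, Real.norm_eq_abs, abs_of_nonneg h2]
  rw [Real.norm_eq_abs, abs_of_nonneg h2] at h3
  refine h1.trans ?_
  rw [show (3 / 2 : ℝ) = 1 / 2 + 1 by norm_num, Real.rpow_add_one' h2 (by norm_num),
    ← Real.sqrt_eq_rpow, mul_assoc]
  gcongr

/-- Along a degenerate direction `F` is affine, so it stays bounded up to any finite exit point,
where it would have to blow up. Hence the ray never leaves the interior and `h` is a recession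
direction. Applied to both `h` and `-h`, this contradicts pointedness and makes the Hessian positive
definite. -/
theorem mem_of_hess_eq_zero (hF : IsNormalBarrier K ν F) (hK : IsRegularCone K) {x h : V}
    (hx : x ∈ interior (K : Set V)) (h0 : hess F x h h = 0) : h ∈ K := by
  have hline : ∀ T, 0 ≤ T → (∀ t ∈ Icc 0 T, x + t • h ∈ interior (K : Set V)) →
      F (x + T • h) = F x + T * grad F x h := by
    intro T hT hU
    have h1 := hF.hess_line_eq_zero hU h0
    have hl : ∀ t : ℝ, HasDerivAt (fun τ : ℝ => x + τ • h) h t := fun t => by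
      simpa using ((hasDerivAt_id t).smul_const h).const_add x
    have hg : ∀ t ∈ Icc 0 T, grad F (x + t • h) h = grad F x h := by
      have := constant_of_has_deriv_right_zero (f := fun t : ℝ => grad F (x + t • h) h)
        (a := 0) (b := T) (fun t ht => ?_) (fun t ht => ?_)
      · simpa using this
      · exact ((HasFDerivAt.comp_hasDerivAt (f := fun τ : ℝ => x + τ • h) (l := grad F) t
          (hF.hasFDerivAt_grad (hU t ht)) (hl t)).clm_apply
            (hasDerivAt_const t h)).continuousAt.continuousWithinAt
      · have h2 := (HasFDerivAt.comp_hasDerivAt (f := fun τ : ℝ => x + τ • h) (l := grad F) t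
          (hF.hasFDerivAt_grad (hU t (Ico_subset_Icc_self ht))) (hl t)).clm_apply
            (hasDerivAt_const t h)
        refine (h2.congr_deriv ?_).hasDerivWithinAt
        simpa using h1 t (Ico_subset_Icc_self ht)
    have hd : ∀ t ∈ Icc 0 T, HasDerivAt (fun t : ℝ => F (x + t • h) - t * grad F x h) 0 t := by
      intro t ht
      have h2 := (HasFDerivAt.comp_hasDerivAt (f := fun τ : ℝ => x + τ • h) (l := F) t
          (hF.hasFDerivAt (hU t ht)) (hl t)).sub ((hasDerivAt_id t).mul_const (grad F x h))
      refine h2.congr_deriv ?_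
      rw [hg t ht]; simp
    have := constant_of_has_deriv_right_zero (f := fun t : ℝ => F (x + t • h) - t * grad F x h)
        (a := 0) (b := T) (fun t ht => (hd t ht).continuousAt.continuousWithinAt)
        (fun t ht => (hd t (Ico_subset_Icc_self ht)).hasDerivWithinAt) T ⟨hT, le_rfl⟩
    simp only [zero_smul, add_zero, zero_mul, sub_zero] at this
    linarith
  have hall : ∀ t : ℝ, 0 ≤ t → x + t • h ∈ interior (K : Set V) := by
    by_contra hcon
    push Not at hcon
    set S : Set ℝ := Ici 0 ∩ (fun t : ℝ => x + t • h) ⁻¹' (interior (K : Set V))ᶜ with hS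
    have hcont : Continuous (fun t : ℝ => x + t • h) := by fun_prop
    have hSc : IsClosed S := isClosed_Ici.inter (isOpen_interior.isClosed_compl.preimage hcont)
    have hSn : S.Nonempty := by obtain ⟨t, ht, ht'⟩ := hcon; exact ⟨t, ht, ht'⟩
    have hSb : BddBelow S := ⟨0, fun t ht => ht.1⟩
    have hmem := hSc.csInf_mem hSn hSb
    set T := sInf S with hT
    have hT0 : 0 < T := by
      refine lt_of_le_of_ne hmem.1 ?_
      intro h0
      apply hmem.2
      rw [← h0]
      simpa using hx
    have hbelow : ∀ t, 0 ≤ t → t < T → x + t • h ∈ interior (K : Set V) := by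
      intro t ht htT
      by_contra hn
      exact absurd (csInf_le hSb (⟨ht, hn⟩ : t ∈ S)) (not_le.2 htT)
    have htend : Tendsto (fun t : ℝ => x + t • h) (𝓝[Ico 0 T] T)
        (𝓝[interior (K : Set V)] (x + T • h)) :=
      tendsto_nhdsWithin_of_tendsto_nhds_of_eventually_within _
        (hcont.continuousAt.tendsto.mono_left nhdsWithin_le_nhds)
        (eventually_nhdsWithin_of_forall fun t ht => hbelow t ht.1 ht.2)
    have : (𝓝[Ico 0 T] T).NeBot := by
      rw [← mem_closure_iff_nhdsWithin_neBot, closure_Ico hT0.ne]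
      exact ⟨hT0.le, le_rfl⟩
    have hfr : x + T • h ∈ frontier (K : Set V) := by
      refine ⟨?_, hmem.2⟩
      refine mem_closure_of_tendsto (htend.mono_right nhdsWithin_le_nhds)
        (eventually_nhdsWithin_of_forall fun t ht => interior_subset (hbelow t ht.1 ht.2))
    have h1 := (hF.tendsto_boundary _ hfr).comp htend
    have h2 : Tendsto (fun t : ℝ => F x + t * grad F x h) (𝓝[Ico 0 T] T)
        (𝓝 (F x + T * grad F x h)) := by
      have : Continuous (fun t : ℝ => F x + t * grad F x h) := by fun_prop
      exact this.continuousAt.tendsto.mono_left nhdsWithin_le_nhds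
    refine not_tendsto_nhds_of_tendsto_atTop (h1.congr' ?_) _ h2
    filter_upwards [self_mem_nhdsWithin] with t ht
    exact hline t ht.1 fun τ hτ => hbelow τ hτ.1 (hτ.2.trans_lt ht.2)
  have hlim : Tendsto (fun t : ℝ => t⁻¹ • (x + t • h)) atTop (𝓝 ((0 : ℝ) • x + h)) := by
    refine Tendsto.congr' ?_ ((tendsto_inv_atTop_zero.smul_const x).add_const h)
    filter_upwards [eventually_gt_atTop 0] with t ht
    rw [smul_add, inv_smul_smul₀ ht.ne']
  rw [zero_smul, zero_add] at hlim
  refine hK.isClosed.mem_of_tendsto hlim ?_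
  filter_upwards [eventually_gt_atTop 0] with t ht
  exact K.smul_mem (inv_pos.2 ht) (interior_subset (hall t ht.le))

theorem spd (hF : IsNormalBarrier K ν F) (hK : IsRegularCone K) {x : V}
    (hx : x ∈ interior (K : Set V)) : IsSPD (hess F x) where
  symm := hF.hess_symm hx
  pos v hv := by
    refine lt_of_le_of_ne (hF.hess_nonneg hx v) fun h0 => ?_
    exact hK.salient v (hF.mem_of_hess_eq_zero hK hx h0.symm) hv
      (hF.mem_of_hess_eq_zero hK hx (by simpa using h0.symm))

theorem abs_third_le (hF : IsNormalBarrier K ν F) (hK : IsRegularCone K) {x : V}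
    (hx : x ∈ interior (K : Set V)) (v u : V) :
    |fderiv ℝ (hess F) x v u u| ≤ 2 * opNorm (hess F x) v * hess F x u u := by
  refine (hF.spd hK hx).abs_trilinear_le _ (hF.third_symm_left hx) (hF.third_symm_right hx) ?_ v u
  intro h
  have h1 := hF.selfConcordant x hx h
  rw [iteratedFDeriv_three] at h1
  refine h1.trans (le_of_eq ?_)
  have h2 := hF.hess_nonneg hx h
  rw [show (3 / 2 : ℝ) = 1 / 2 + 1 by norm_num, Real.rpow_add_one' h2 (by norm_num),
    ← Real.sqrt_eq_rpow, pow_succ', (hF.spd hK hx).sq_opNorm]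
  rfl

theorem isSelfConcordantGrad (hF : IsNormalBarrier K ν F) (hK : IsRegularCone K) :
    IsSelfConcordantGrad (interior (K : Set V)) (grad F) (hess F) where
  convex := K.convex.interior
  hasFDerivAt _ hx := hF.hasFDerivAt_grad hx
  spd _ hx := hF.spd hK hx
  exists_deriv _ hx v u := ⟨_, hF.hasDerivAt_hess_apply hx v u u, hF.abs_third_le hK hx v u⟩

end IsNormalBarrier

end NormalBarrier

end ConicIPM

/-! ### The Legendre transform and the dual barrier. -/

namespace ConicIPM

section Legendre

variable {V : Type*} [NormedAddCommGroup V] [NormedSpace ℝ V]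
  {K : ConvexCone ℝ V} {ν : ℝ} {F : V → ℝ}

namespace IsNormalBarrier

/-- By convexity `⟨∇F(x), u⟩` is at most the slope of `F` from `x` to `x + t⁻¹u`. By homogeneity `F`
there equals `F(u + t x) + ν log t`, so for `u` in the interior the slope tends to 0 as `t → 0`. -/
theorem grad_apply_nonpos (hF : IsNormalBarrier K ν F) {x u : V}
    (hx : x ∈ interior (K : Set V)) (hu : u ∈ K) : grad F x u ≤ 0 := by
  have hint : ∀ u ∈ interior (K : Set V), grad F x u ≤ 0 := by
    intro u hu
    have hlim : Tendsto (fun t : ℝ => t * (F (u + t • x) - F x - ν * Real.log t⁻¹)) (𝓝[>] 0)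
        (𝓝 (0 * (F u - F x) + ν * 0)) := by
      have h1 : Tendsto (fun t : ℝ => F (u + t • x)) (𝓝[>] 0) (𝓝 (F u)) := by
        have hc : ContinuousAt F u := (hF.hasFDerivAt hu).continuousAt
        have h2 : Tendsto (fun t : ℝ => u + t • x) (𝓝[>] 0) (𝓝 u) := by
          have h3 : Continuous (fun t : ℝ => u + t • x) := by fun_prop
          simpa using h3.continuousAt.tendsto.mono_left (nhdsWithin_le_nhds (a := (0 : ℝ)))
        exact hc.tendsto.comp h2
      have h4 : Tendsto (fun t : ℝ => t) (𝓝[>] 0) (𝓝 0) := nhdsWithin_le_nhds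
      have h5 : Tendsto (fun t : ℝ => t * Real.log t) (𝓝[>] 0) (𝓝 0) := by
        simpa using Real.continuous_mul_log.continuousAt.tendsto.mono_left
          (nhdsWithin_le_nhds (a := (0 : ℝ)))
      refine ((h4.mul (h1.sub_const (F x))).add (h5.const_mul ν)).congr fun t => ?_
      rw [Real.log_inv]; ring
    rw [zero_mul, mul_zero, add_zero] at hlim
    refine ge_of_tendsto hlim ?_
    filter_upwards [self_mem_nhdsWithin] with t ht
    have ht' : (0 : ℝ) < t := ht
    have h6 : x + t⁻¹ • u ∈ interior (K : Set V) :=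
      add_mem_interior hx (K.smul_mem (inv_pos.2 ht') (interior_subset hu))
    have h7 := hF.le_sub hx h6
    have h8 : x + t⁻¹ • u = t⁻¹ • (u + t • x) := by
      rw [smul_add, inv_smul_smul₀ ht'.ne', add_comm]
    have h9 : u + t • x ∈ interior (K : Set V) :=
      add_mem_interior hu (K.smul_mem ht' (interior_subset hx))
    rw [add_sub_cancel_left, map_smul, smul_eq_mul, h8,
      hF.logHomogeneous _ h9 _ (inv_pos.2 ht')] at h7
    calc grad F x u = t * (t⁻¹ * grad F x u) := by rw [mul_inv_cancel_left₀ ht'.ne']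
      _ ≤ t * (F (u + t • x) - ν * Real.log t⁻¹ - F x) := by gcongr
      _ = _ := by ring
  have hlim : Tendsto (fun t : ℝ => grad F x (u + t • x)) (𝓝[>] 0) (𝓝 (grad F x u)) := by
    have h3 : Continuous (fun t : ℝ => grad F x (u + t • x)) := by fun_prop
    simpa using h3.continuousAt.tendsto.mono_left (nhdsWithin_le_nhds (a := (0 : ℝ)))
  refine le_of_tendsto hlim ?_
  filter_upwards [self_mem_nhdsWithin] with t ht
  apply hint
  rw [add_comm]
  exact add_mem_interior (smul_mem_interior ht hx) hu

theorem opNorm_le_neg_grad (hF : IsNormalBarrier K ν F) (hK : IsRegularCone K) {x u : V}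
    (hx : x ∈ interior (K : Set V)) (hu : u ∈ K) : opNorm (hess F x) u ≤ -(grad F x u) := by
  have hU : ∀ t : ℝ, 0 ≤ t → x + t • u ∈ interior (K : Set V) :=
    fun t ht => add_mem_interior hx (hK.smul_mem ht hu)
  exact (hF.isSelfConcordantGrad hK).opNorm_le_of_recession hU
    fun t ht => hF.grad_apply_nonpos (hU t ht) hu

theorem grad_injOn (hF : IsNormalBarrier K ν F) (hK : IsRegularCone K) :
    InjOn (grad F) (interior (K : Set V)) := by
  intro x hx y hy hxy
  by_contra hne
  have h1 := (hF.isSelfConcordantGrad hK).le_grad_sub hx hy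
  have h2 := (hF.spd hK hx).opNorm_pos (sub_ne_zero.2 (Ne.symm hne))
  rw [hxy, sub_self] at h1
  have : 0 < opNorm (hess F x) (y - x) ^ 2 / (1 + opNorm (hess F x) (y - x)) := by positivity
  linarith

theorem hess_self_self (hF : IsNormalBarrier K ν F) {x : V} (hx : x ∈ interior (K : Set V)) :
    hess F x x x = ν := by
  rw [hF.hess_self hx, neg_apply, hF.grad_self hx, neg_neg]

variable [FiniteDimensional ℝ V]

/-- The barrier subproblem over a closed set has a solution. -/
theorem exists_minimizer (hF : IsNormalBarrier K ν F)
    {s : StrongDual ℝ V} (hs : s ∈ interior (dualCone K)) {μ : ℝ} (hμ : 0 < μ) {C : Set V}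
    (hC : IsClosed C) (hne : (C ∩ interior (K : Set V)).Nonempty) :
    ∃ x ∈ C ∩ interior (K : Set V), ∀ y ∈ C ∩ interior (K : Set V),
      s x + μ * F x ≤ s y + μ * F y := by
  obtain ⟨x₀, hx₀⟩ := hne
  set C₀ := s x₀ + μ * F x₀ with hC₀
  set S : Set V := {x | x ∈ C ∩ interior (K : Set V) ∧ s x + μ * F x ≤ C₀} with hS
  have hν := hF.nu_nonneg hx₀.2
  obtain ⟨c, hc, hcK⟩ := exists_norm_le_of_mem_interior_dualCone hs
  have hcont : ContinuousOn (fun x => s x + μ * F x) (interior (K : Set V)) :=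
    s.continuous.continuousOn.add (hF.contDiffOn.continuousOn.const_smul μ)
  have hbdd : ∃ R, ∀ x ∈ S, ‖x‖ ≤ R := by
    set m := F x₀ - grad F x₀ x₀ - ‖grad F x₀‖ with hm
    -- Coercivity: `F` decreases at most like `-ν log ‖x‖`, and `log ‖x‖ ≤ a‖x‖ - 1 - log a`. This
    -- `a` makes `μνa ≤ c/2`, so half of the linear growth `c‖x‖` of `s` survives.
    set a := c / (2 * (μ * ν + 1)) with ha
    have hden : 0 < 2 * (μ * ν + 1) := by positivity
    have ha0 : 0 < a := div_pos hc hden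
    have hac : μ * ν * a ≤ c / 2 := by
      rw [ha, ← mul_div_assoc, div_le_div_iff₀ hden two_pos]
      nlinarith
    set R := (C₀ - μ * m - μ * ν * (1 + Real.log a)) / (c / 2) with hR
    refine ⟨max R 0, fun x hx => ?_⟩
    rcases eq_or_ne x 0 with rfl | hx0
    · simp
    refine le_max_of_le_left ?_
    have hn : 0 < ‖x‖ := norm_pos_iff.2 hx0
    have h1 : ‖x‖⁻¹ • x ∈ interior (K : Set V) := smul_mem_interior (inv_pos.2 hn) hx.1.2
    have h2 := hF.le_sub hx₀.2 h1
    have h3 := hF.logHomogeneous x hx.1.2 _ (inv_pos.2 hn)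
    have h4 : -‖grad F x₀‖ ≤ grad F x₀ (‖x‖⁻¹ • x) := by
      have h5 := (abs_le.1 ((grad F x₀).le_opNorm (‖x‖⁻¹ • x))).1
      rwa [norm_smul, norm_inv, norm_norm, inv_mul_cancel₀ hn.ne', mul_one] at h5
    rw [map_sub, h3, Real.log_inv] at h2
    have h5 : m - ν * Real.log ‖x‖ ≤ F x := by rw [hm]; linarith
    have h6 : Real.log ‖x‖ ≤ a * ‖x‖ - 1 - Real.log a := by
      have := Real.log_le_sub_one_of_pos (mul_pos ha0 hn)
      rw [Real.log_mul ha0.ne' hn.ne'] at this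
      linarith
    have h7 := hcK x (interior_subset hx.1.2)
    have h8 := hx.2
    have h9 : μ * (m - ν * Real.log ‖x‖) ≤ μ * F x := by gcongr
    have h10 : μ * ν * Real.log ‖x‖ ≤ μ * ν * (a * ‖x‖ - 1 - Real.log a) := by gcongr
    have h11 : μ * ν * a * ‖x‖ ≤ c / 2 * ‖x‖ := by gcongr
    rw [hR, le_div_iff₀ (by positivity)]
    nlinarith
  have hclosed : IsClosed S := by
    rw [← closure_subset_iff_isClosed]
    intro z hz
    have hzC : z ∈ C := closure_minimal (fun x hx => hx.1.1) hC hz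
    have hzI : z ∈ interior (K : Set V) := by
      by_contra hn
      have hfr : z ∈ frontier (K : Set V) :=
        ⟨closure_mono (fun x hx => interior_subset hx.1.2) hz, hn⟩
      have hNe : (𝓝[S] z).NeBot := mem_closure_iff_nhdsWithin_neBot.1 hz
      have h1 : Tendsto F (𝓝[S] z) atTop :=
        (hF.tendsto_boundary z hfr).mono_left (nhdsWithin_mono z fun x hx => hx.1.2)
      have h2 : Tendsto (fun x => s x + μ * F x) (𝓝[S] z) atTop :=
        (s.continuous.continuousAt.tendsto.mono_left nhdsWithin_le_nhds).add_atTop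
          (h1.const_mul_atTop hμ)
      obtain ⟨x, hx1, hx2⟩ :=
        ((h2.eventually_gt_atTop C₀).and self_mem_nhdsWithin).exists
      exact absurd hx2.2 (not_le.2 hx1)
    refine ⟨⟨hzC, hzI⟩, ?_⟩
    have hNe : (𝓝[S] z).NeBot := mem_closure_iff_nhdsWithin_neBot.1 hz
    have h1 : Tendsto (fun x => s x + μ * F x) (𝓝[S] z) (𝓝 (s z + μ * F z)) :=
      (hcont z hzI).tendsto.mono_left (nhdsWithin_mono z fun x hx => hx.1.2)
    exact le_of_tendsto h1 (eventually_nhdsWithin_of_forall fun x hx => hx.2)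
  have hcomp : IsCompact S := by
    obtain ⟨R, hR⟩ := hbdd
    refine Metric.isCompact_of_isClosed_isBounded hclosed ?_
    exact (Metric.isBounded_closedBall (x := (0 : V)) (r := R)).subset fun x hx => by
      simpa using hR x hx
  obtain ⟨x, hxS, hx⟩ := hcomp.exists_isMinOn ⟨x₀, hx₀, le_rfl⟩
    (hcont.mono fun x hx => hx.1.2)
  refine ⟨x, hxS.1, fun y hy => ?_⟩
  rcases le_total (s y + μ * F y) C₀ with h | h
  · exact hx ⟨hy, h⟩
  · exact hxS.2.trans h

theorem exists_grad_eq_neg (hF : IsNormalBarrier K ν F) (hK : IsRegularCone K)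
    {s : StrongDual ℝ V} (hs : s ∈ interior (dualCone K)) :
    ∃ x ∈ interior (K : Set V), grad F x = -s := by
  obtain ⟨x, hx, hmin⟩ := hF.exists_minimizer hs one_pos isClosed_univ
    (by simpa using hK.nonempty_interior)
  refine ⟨x, hx.2, ?_⟩
  have hloc : IsLocalMin (fun x => s x + F x) x := by
    filter_upwards [isOpen_interior.mem_nhds hx.2] with y hy
    simpa using hmin y ⟨mem_univ y, hy⟩
  have h := hloc.hasFDerivAt_eq_zero (s.hasFDerivAt.add (hF.hasFDerivAt hx.2))
  exact (neg_eq_of_add_eq_zero_right h).symm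

/-- The Dikin ellipsoid of the dual cone, in terms of the primal barrier. -/
theorem smul_neg_grad_add_mem (hF : IsNormalBarrier K ν F) (hK : IsRegularCone K) {z : V}
    (hz : z ∈ interior (K : Set V)) {w : StrongDual ℝ V} {τ : ℝ}
    (hw : opDualNorm (hess F z) w ≤ τ) : τ • (-grad F z) + w ∈ dualCone K := by
  intro u hu
  have hτ : 0 ≤ τ := (Real.sqrt_nonneg _).trans hw
  have h1 := hF.opNorm_le_neg_grad hK hz hu
  have h2 := (hF.spd hK hz).neg_le_dual_apply w u
  have h3 : opDualNorm (hess F z) w * opNorm (hess F z) u ≤ τ * -(grad F z u) := by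
    gcongr
    exact IsSPD.opNorm_nonneg _ _
  simp only [add_apply, smul_apply, neg_apply, smul_eq_mul]
  linarith

theorem neg_grad_mem (hF : IsNormalBarrier K ν F) (hK : IsRegularCone K) {z : V}
    (hz : z ∈ interior (K : Set V)) : -grad F z ∈ interior (dualCone K) := by
  rw [mem_interior_iff_mem_nhds]
  have hc : Continuous fun s : StrongDual ℝ V =>
      (s + grad F z) ((hess F z).inverse (s + grad F z)) := by
    have h1 : Continuous fun s : StrongDual ℝ V => s + grad F z := by fun_prop
    exact h1.clm_apply ((hess F z).inverse.continuous.comp h1)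
  have h := (hc.tendsto (-grad F z)).eventually_lt_const (u := 1) (by simp)
  filter_upwards [h] with s hs
  have h1 := hF.smul_neg_grad_add_mem hK hz (w := s + grad F z) (τ := 1) (by
    rw [opDualNorm]
    exact Real.sqrt_le_one.2 hs.le)
  simpa using h1

end IsNormalBarrier

/-- The maximizer in the definition of the dual barrier. -/
def legendrePoint (K : ConvexCone ℝ V) (F : V → ℝ) (s : StrongDual ℝ V) : V :=
  Classical.epsilon fun x => x ∈ interior (K : Set V) ∧ grad F x = -s

namespace IsNormalBarrier

variable [FiniteDimensional ℝ V]

theorem legendrePoint_spec (hF : IsNormalBarrier K ν F) (hK : IsRegularCone K)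
    {s : StrongDual ℝ V} (hs : s ∈ interior (dualCone K)) :
    legendrePoint K F s ∈ interior (K : Set V) ∧ grad F (legendrePoint K F s) = -s := by
  obtain ⟨x, hx⟩ := hF.exists_grad_eq_neg hK hs
  exact Classical.epsilon_spec (p := fun x => x ∈ interior (K : Set V) ∧ grad F x = -s) ⟨x, hx⟩

theorem legendrePoint_mem (hF : IsNormalBarrier K ν F) (hK : IsRegularCone K)
    {s : StrongDual ℝ V} (hs : s ∈ interior (dualCone K)) :
    legendrePoint K F s ∈ interior (K : Set V) :=
  (hF.legendrePoint_spec hK hs).1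

theorem grad_legendrePoint (hF : IsNormalBarrier K ν F) (hK : IsRegularCone K)
    {s : StrongDual ℝ V} (hs : s ∈ interior (dualCone K)) :
    grad F (legendrePoint K F s) = -s :=
  (hF.legendrePoint_spec hK hs).2

theorem legendrePoint_eq (hF : IsNormalBarrier K ν F) (hK : IsRegularCone K)
    {s : StrongDual ℝ V} {x : V} (hx : x ∈ interior (K : Set V)) (h : grad F x = -s) :
    legendrePoint K F s = x := by
  have hs : s ∈ interior (dualCone K) := by simpa [h] using hF.neg_grad_mem hK hx
  exact hF.grad_injOn hK (hF.legendrePoint_mem hK hs) hx ((hF.grad_legendrePoint hK hs).trans h.symm)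

/-- Inverse function theorem: `t ↦ legendrePoint K F (-t)` is a local left inverse of `grad F`,
whose derivative is invertible. -/
theorem hasFDerivAt_legendrePoint (hF : IsNormalBarrier K ν F) (hK : IsRegularCone K)
    {s : StrongDual ℝ V} (hs : s ∈ interior (dualCone K)) :
    HasFDerivAt (legendrePoint K F) (-(hess F (legendrePoint K F s)).inverse) s := by
  obtain ⟨hx, hg⟩ := hF.legendrePoint_spec hK hs
  set x := legendrePoint K F s
  obtain ⟨e, he⟩ := (hF.spd hK hx).exists_equiv
  have h1 : HasStrictFDerivAt (grad F) (e : V →L[ℝ] StrongDual ℝ V) x := by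
    rw [he]
    exact (hF.contDiffAt_grad hx).hasStrictFDerivAt (by norm_num)
  have : CompleteSpace V := FiniteDimensional.complete ℝ V
  have h2 := h1.to_local_left_inverse (g := fun t => legendrePoint K F (-t)) (by
    filter_upwards [isOpen_interior.mem_nhds hx] with z hz
    exact hF.legendrePoint_eq hK hz (neg_neg _).symm)
  rw [hg] at h2
  have h3 := h2.hasFDerivAt.comp s (f := fun t => -t) (hasFDerivAt_id s).neg
  refine (h3.congr_of_eventuallyEq (.of_forall fun t => ?_)).congr_fderiv ?_
  · simp
  · rw [← he, ContinuousLinearMap.inverse_equiv]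
    ext u; simp

theorem dualBarrier_eq (hF : IsNormalBarrier K ν F) (hK : IsRegularCone K)
    {s : StrongDual ℝ V} (hs : s ∈ interior (dualCone K)) :
    dualBarrier K F s = -(s (legendrePoint K F s)) - F (legendrePoint K F s) := by
  obtain ⟨hx, hg⟩ := hF.legendrePoint_spec hK hs
  set x := legendrePoint K F s
  refine IsGreatest.csSup_eq ⟨⟨⟨x, hx⟩, rfl⟩, ?_⟩
  rintro _ ⟨⟨y, hy⟩, rfl⟩
  have h := hF.le_sub hx hy
  rw [hg] at h
  simp only [neg_apply, map_sub] at h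
  simp only
  linarith

/-- Envelope argument: the terms containing the derivative of the maximizer cancel because `∇F = -s`
there. -/
theorem hasFDerivAt_dualBarrier (hF : IsNormalBarrier K ν F) (hK : IsRegularCone K)
    {s : StrongDual ℝ V} (hs : s ∈ interior (dualCone K)) :
    HasFDerivAt (dualBarrier K F)
      (-(NormedSpace.inclusionInDoubleDual ℝ V (legendrePoint K F s))) s := by
  have h1 := hF.hasFDerivAt_legendrePoint hK hs
  have h2 := ((hasFDerivAt_id s).clm_apply h1).neg.sub
    ((hF.hasFDerivAt (hF.legendrePoint_mem hK hs)).comp s h1)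
  refine (h2.congr_of_eventuallyEq ?_).congr_fderiv ?_
  · filter_upwards [isOpen_interior.mem_nhds hs] with t ht
    exact hF.dualBarrier_eq hK ht
  · ext u
    simp [hF.grad_legendrePoint hK hs]

theorem grad_dualBarrier (hF : IsNormalBarrier K ν F) (hK : IsRegularCone K)
    {s : StrongDual ℝ V} (hs : s ∈ interior (dualCone K)) :
    grad (dualBarrier K F) s = -(NormedSpace.inclusionInDoubleDual ℝ V (legendrePoint K F s)) :=
  (hF.hasFDerivAt_dualBarrier hK hs).fderiv

theorem hasFDerivAt_grad_dualBarrier (hF : IsNormalBarrier K ν F) (hK : IsRegularCone K)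
    {s : StrongDual ℝ V} (hs : s ∈ interior (dualCone K)) :
    HasFDerivAt (grad (dualBarrier K F))
      (NormedSpace.inclusionInDoubleDual ℝ V ∘L (hess F (legendrePoint K F s)).inverse) s := by
  have h1 := (HasFDerivAt.comp s (g := fun z => NormedSpace.inclusionInDoubleDual ℝ V z)
    (ContinuousLinearMap.hasFDerivAt _) (hF.hasFDerivAt_legendrePoint hK hs)).neg
  refine (h1.congr_of_eventuallyEq ?_).congr_fderiv ?_
  · filter_upwards [isOpen_interior.mem_nhds hs] with t ht
    exact hF.grad_dualBarrier hK ht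
  · ext u v; simp

theorem hess_dualBarrier (hF : IsNormalBarrier K ν F) (hK : IsRegularCone K)
    {s : StrongDual ℝ V} (hs : s ∈ interior (dualCone K)) :
    hess (dualBarrier K F) s =
      NormedSpace.inclusionInDoubleDual ℝ V ∘L (hess F (legendrePoint K F s)).inverse :=
  (hF.hasFDerivAt_grad_dualBarrier hK hs).fderiv

theorem hess_dualBarrier_apply (hF : IsNormalBarrier K ν F) (hK : IsRegularCone K)
    {s : StrongDual ℝ V} (hs : s ∈ interior (dualCone K)) (u w : StrongDual ℝ V) :
    hess (dualBarrier K F) s u w = w ((hess F (legendrePoint K F s)).inverse u) := by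
  rw [hF.hess_dualBarrier hK hs]; rfl

theorem opNorm_hess_dualBarrier (hF : IsNormalBarrier K ν F) (hK : IsRegularCone K)
    {s : StrongDual ℝ V} (hs : s ∈ interior (dualCone K)) (u : StrongDual ℝ V) :
    opNorm (hess (dualBarrier K F) s) u = opDualNorm (hess F (legendrePoint K F s)) u := by
  rw [opNorm, hF.hess_dualBarrier_apply hK hs, opDualNorm]

/-- Put `M(t) = ∇²F` at the Legendre point of `s + t v` and `w = M⁻¹u`. Differentiating `M w = u`
shows that the derivative of `⟨u, M⁻¹u⟩` at 0 is `∇³F(x)[M⁻¹v, w, w]`. The bound for `F` then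
transfers, since `M` carries the local norms of `M⁻¹v` and `w` to the dual norms of `v` and `u`. -/
theorem isSelfConcordantGrad_dualBarrier (hF : IsNormalBarrier K ν F) (hK : IsRegularCone K) :
    IsSelfConcordantGrad (interior (dualCone K)) (grad (dualBarrier K F))
      (hess (dualBarrier K F)) where
  convex := convex_dualCone.interior
  hasFDerivAt s hs := by
    rw [hF.hess_dualBarrier hK hs]
    exact hF.hasFDerivAt_grad_dualBarrier hK hs
  spd s hs := by
    have hB := hF.spd hK (hF.legendrePoint_mem hK hs)
    constructor
    · intro u v
      rw [hF.hess_dualBarrier_apply hK hs, hF.hess_dualBarrier_apply hK hs, hB.inverse_symm]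
    · intro u hu
      rw [hF.hess_dualBarrier_apply hK hs]
      exact hB.inverse_pos hu
  exists_deriv s hs v u := by
    have hx := hF.legendrePoint_mem hK hs
    set x := legendrePoint K F s with hxdef
    have hB := hF.spd hK hx
    set M : ℝ → V →L[ℝ] StrongDual ℝ V := fun t => hess F (legendrePoint K F (s + t • v)) with hM
    have hline := eventually_mem_line isOpen_interior hs v
    have hM' : HasDerivAt M (fderiv ℝ (hess F) x (-((hess F x).inverse v))) 0 := by
      have h1 : HasDerivAt (fun τ : ℝ => s + τ • v) v 0 := by
        simpa using ((hasDerivAt_id (0 : ℝ)).smul_const v).const_add s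
      have h2 : HasDerivAt (fun τ : ℝ => legendrePoint K F (s + τ • v))
          (-((hess F x).inverse v)) 0 :=
        HasFDerivAt.comp_hasDerivAt (f := fun τ : ℝ => s + τ • v) (l := legendrePoint K F)
          (l' := -(hess F x).inverse) 0 (by simpa using hF.hasFDerivAt_legendrePoint hK hs) h1
      exact HasFDerivAt.comp_hasDerivAt (f := fun τ : ℝ => legendrePoint K F (s + τ • v))
        (l := hess F) 0 (by simpa using hF.hasFDerivAt_hess hx) h2
    have hM0 : M 0 = hess F x := by simp [hM, hxdef]
    set w : ℝ → V := fun t => (M t).inverse u with hw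
    have hw' : ∃ w', HasDerivAt w w' 0 := by
      obtain ⟨e, he⟩ := hB.exists_equiv
      have : CompleteSpace V := FiniteDimensional.complete ℝ V
      have h1 := (contDiffAt_map_inverse (𝕜 := ℝ) (n := 1) e).differentiableAt one_ne_zero
      rw [he, ← hM0] at h1
      have h2 := h1.hasFDerivAt.comp_hasDerivAt (0 : ℝ) hM'
      exact ⟨_, h2.clm_apply (hasDerivAt_const 0 u)⟩
    obtain ⟨w', hw'⟩ := hw'
    have hw0 : w 0 = (hess F x).inverse u := by simp only [hw, hM0]
    have hzero : fderiv ℝ (hess F) x (-((hess F x).inverse v)) (w 0) + hess F x w' = 0 := by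
      have h1 := hM'.clm_apply hw'
      rw [hM0] at h1
      refine h1.unique ((hasDerivAt_const 0 u).congr_of_eventuallyEq ?_)
      filter_upwards [hline] with t ht
      exact (hF.spd hK (hF.legendrePoint_mem hK ht)).apply_inverse u
    have hval : u w' = fderiv ℝ (hess F) x ((hess F x).inverse v) (w 0) (w 0) := by
      have h1 := DFunLike.congr_fun hzero (w 0)
      simp only [map_neg, add_apply, neg_apply, zero_apply] at h1
      rw [hB.symm, hw0, hB.apply_inverse, ← hw0] at h1
      linarith
    refine ⟨u w', ?_, ?_⟩
    · refine HasDerivAt.congr_of_eventuallyEq (f := fun t => u (w t))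
        (u.hasFDerivAt.comp_hasDerivAt 0 hw') ?_
      filter_upwards [hline] with t ht
      rw [hF.hess_dualBarrier_apply hK ht]
    · rw [hval]
      have h1 := hF.abs_third_le hK hx ((hess F x).inverse v) (w 0)
      rw [hF.opNorm_hess_dualBarrier hK hs, hF.hess_dualBarrier_apply hK hs]
      rw [hB.opNorm_inverse, hw0, hB.apply_inverse, ← hw0] at h1
      rw [← hxdef, ← hw0]
      exact h1

theorem opDualNorm_le_apply (hF : IsNormalBarrier K ν F) (hK : IsRegularCone K)
    {s u : StrongDual ℝ V} (hs : s ∈ interior (dualCone K)) (hu : u ∈ dualCone K) :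
    opDualNorm (hess F (legendrePoint K F s)) u ≤ u (legendrePoint K F s) := by
  have hU : ∀ t : ℝ, 0 ≤ t → s + t • u ∈ interior (dualCone K) :=
    fun t ht => add_mem_interior_dualCone hs (smul_mem_dualCone ht hu)
  have h := (hF.isSelfConcordantGrad_dualBarrier hK).opNorm_le_of_recession hU (fun t ht => by
    rw [hF.grad_dualBarrier hK (hU t ht)]
    have := hu _ (interior_subset (hF.legendrePoint_mem hK (hU t ht)))
    simpa using this)
  rw [hF.opNorm_hess_dualBarrier hK hs, hF.grad_dualBarrier hK hs] at h
  simpa using h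

/-- The Dikin ellipsoid of the primal cone. -/
theorem smul_add_mem (hF : IsNormalBarrier K ν F) (hK : IsRegularCone K) {z h : V}
    (hz : z ∈ interior (K : Set V)) {τ : ℝ} (hh : opNorm (hess F z) h ≤ τ) :
    τ • z + h ∈ K := by
  refine hK.mem_of_dual fun u hu => ?_
  have hτ : 0 ≤ τ := (Real.sqrt_nonneg _).trans hh
  have h1 := hF.opDualNorm_le_apply hK (hF.neg_grad_mem hK hz) hu
  rw [hF.legendrePoint_eq hK hz (neg_neg _).symm] at h1
  have h2 := (hF.spd hK hz).neg_le_dual_apply u h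
  have h3 : opDualNorm (hess F z) u * opNorm (hess F z) h ≤ u z * τ := by
    gcongr
    · exact IsSPD.opNorm_nonneg _ _
    · exact (Real.sqrt_nonneg _).trans h1
  rw [map_add, map_smul, smul_eq_mul]
  linarith

/-- Comparison of local norms at two interior points. -/
theorem opNorm_le_mul_opNorm (hF : IsNormalBarrier K ν F) (hK : IsRegularCone K) {x z : V}
    (hx : x ∈ interior (K : Set V)) (hz : z ∈ interior (K : Set V)) (h : V) :
    opNorm (hess F x) h ≤ -(grad F x z) * opNorm (hess F z) h := by
  set τ := opNorm (hess F z) h with hτ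
  have h1 := hF.opNorm_le_neg_grad hK hx (hF.smul_add_mem hK hz (h := h) le_rfl)
  have h2 := hF.opNorm_le_neg_grad hK hx (hF.smul_add_mem hK hz (h := -h)
    (by rw [IsSPD.opNorm_neg]))
  -- `2h` is the difference of two points of `K`; the norm of each is bounded by `-∇F(x)` applied to
  -- it, and these bounds sum to `-2τ⟨∇F(x), z⟩`.
  have h3 := (hF.spd hK hx).opNorm_add_le (τ • z + h) (-(τ • z + -h))
  rw [IsSPD.opNorm_neg, show τ • z + h + -(τ • z + -h) = (2 : ℝ) • h by module,
    IsSPD.opNorm_smul, abs_two] at h3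
  simp only [map_add, map_smul, smul_eq_mul, map_neg] at h1 h2
  linarith

end IsNormalBarrier

end Legendre

end ConicIPM

/-! ### The barrier of `Q` and existence of the central path. -/

namespace ConicIPM

theorem ofBidual_inclusion {V : Type*} [NormedAddCommGroup V] [NormedSpace ℝ V]
    [FiniteDimensional ℝ V] (w : V) :
    ofBidual (NormedSpace.inclusionInDoubleDual ℝ V w) = w :=
  (SeparatingDual.eq_iff_forall_dual_eq (R := ℝ)).2 fun g => by rw [apply_ofBidual]; simp

section Conjugation

variable {E H : Type*} [NormedAddCommGroup E] [NormedSpace ℝ E]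
  [NormedAddCommGroup H] [NormedSpace ℝ H] {A : E →L[ℝ] StrongDual ℝ H}
  {B : E →L[ℝ] StrongDual ℝ E}

theorem flip_ne_zero (hA : Function.Surjective A) {h : H} (hh : h ≠ 0) : A.flip h ≠ 0 := by
  intro h0
  obtain ⟨φ, hφ⟩ := SeparatingDual.exists_ne_zero (R := ℝ) hh
  obtain ⟨x, rfl⟩ := hA φ
  exact hφ (by simpa using DFunLike.congr_fun h0 x)

theorem IsSPD.conjugate_inverse [FiniteDimensional ℝ E] (hB : IsSPD B) (hA : Function.Surjective A) :
    IsSPD (A ∘L B.inverse ∘L A.flip) where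
  symm u v := hB.inverse_symm (A.flip v) (A.flip u)
  pos _ hv := hB.inverse_pos (flip_ne_zero hA hv)

end Conjugation

namespace ConicProblem

variable {E H : Type*} [NormedAddCommGroup E] [NormedSpace ℝ E]
  [NormedAddCommGroup H] [NormedSpace ℝ H] {P : ConicProblem E H}

theorem Aadj_apply (y : H) (x : E) : P.Aadj y x = P.A x y := rfl

theorem slack_apply (y : H) (x : E) : P.slack y x = P.c x - P.A x y := rfl

theorem slack_add (y h : H) : P.slack (y + h) = P.slack y - P.Aadj h := by
  simp only [slack, map_add]; abel

theorem IsCentralPoint.slack_eq {μ : ℝ} {z : E × StrongDual ℝ E × H}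
    (hz : P.IsCentralPoint μ z) : P.slack z.2.2 = z.2.1 := by
  rw [slack, ← hz.2.2.1, hz.2.2.2]
  abel

theorem fStar_eq {yStar : H} (hopt : P.IsDualOptimal yStar) : P.fStar = P.b yStar := by
  refine IsGreatest.csSup_eq ⟨⟨yStar, hopt.1, rfl⟩, ?_⟩
  rintro _ ⟨y, hy, rfl⟩
  exact hopt.2 y hy

/-- Going slightly past `y` from `y₀` stays in `Q`, so `s(y)` is a convex combination of the
interior point `s₀`, with positive weight, and an element of the dual cone. -/
theorem slack_mem_interior (hfeas : P.StrictlyFeasible) {y : H} (hy : y ∈ interior P.Q) :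
    P.slack y ∈ interior (dualCone P.K) := by
  obtain ⟨-, s₀, hs₀, y₀, hy₀⟩ := hfeas
  have h := (IsNormalBarrier.eventually_mem_line isOpen_interior hy (y - y₀)).filter_mono
    (nhdsWithin_le_nhds : 𝓝[>] (0 : ℝ) ≤ 𝓝 0)
  obtain ⟨t, ht, ht0⟩ := (h.and self_mem_nhdsWithin).exists
  have ht0 : (0 : ℝ) < t := ht0
  have h1 : P.slack (y + t • (y - y₀)) ∈ dualCone P.K :=
    (interior_subset ht : _ ∈ P.Q)
  have h2 : P.slack y = (1 + t)⁻¹ • (t • s₀ + P.slack (y + t • (y - y₀))) := by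
    rw [eq_inv_smul_iff₀ (by positivity)]
    have hs : s₀ = P.c - P.Aadj y₀ := eq_sub_of_add_eq hy₀
    simp only [slack, hs, map_add, map_smul, map_sub]
    module
  rw [h2]
  exact smul_mem_interior_dualCone (by positivity)
    (add_mem_interior_dualCone (smul_mem_interior_dualCone ht0 hs₀) h1)

theorem exists_Aadj_eq (hA : Function.Surjective P.A) [FiniteDimensional ℝ H]
    {φ : StrongDual ℝ E} (hφ : ∀ h, P.A h = 0 → φ h = 0) : ∃ y, φ = P.Aadj y := by
  obtain ⟨R, hR⟩ := P.A.toLinearMap.exists_rightInverse_of_surjective (LinearMap.range_eq_top.2 hA)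
  have hR' : ∀ s, P.A (R s) = s := fun s => DFunLike.congr_fun hR s
  refine ⟨ofBidual (LinearMap.toContinuousLinearMap (φ.toLinearMap ∘ₗ R)), ?_⟩
  ext x
  rw [Aadj_apply, apply_ofBidual]
  have h := hφ (x - R (P.A x)) (by rw [map_sub, hR', sub_self])
  rw [map_sub, sub_eq_zero] at h
  simpa using h

variable [FiniteDimensional ℝ E]

/-- Minimize `⟨s₀, x⟩ + μF(x)` subject to `A x = b`. Using `s₀` instead of `c` changes the objective
by a constant on this set and makes it coercive; the multiplier is then shifted by `y₀`. -/
theorem exists_isCentralPoint [FiniteDimensional ℝ H] (hF : IsNormalBarrier P.K P.ν P.F)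
    (hA : Function.Surjective P.A) (hfeas : P.StrictlyFeasible) {μ : ℝ} (hμ : 0 < μ) :
    ∃ z, P.IsCentralPoint μ z := by
  obtain ⟨⟨x₀, hx₀, hAx₀⟩, s₀, hs₀, y₀, hy₀⟩ := hfeas
  obtain ⟨x, hx, hmin⟩ := hF.exists_minimizer hs₀ hμ (C := {x | P.A x = P.b})
    (isClosed_eq P.A.continuous continuous_const) ⟨x₀, hAx₀, hx₀⟩
  have hker : ∀ h, P.A h = 0 → (s₀ + μ • grad P.F x) h = 0 := by
    intro h hh
    have hd : HasDerivAt (fun t : ℝ => s₀ (x + t • h) + μ * P.F (x + t • h))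
        ((s₀ + μ • grad P.F x) h) 0 := by
      have h1 : HasDerivAt (fun τ : ℝ => x + τ • h) h 0 := by
        simpa using ((hasDerivAt_id (0 : ℝ)).smul_const h).const_add x
      exact HasFDerivAt.comp_hasDerivAt (f := fun τ : ℝ => x + τ • h)
        (l := fun z => s₀ z + μ * P.F z) (l' := s₀ + μ • grad P.F x) 0
        (by rw [zero_smul, add_zero]
            exact s₀.hasFDerivAt.add ((hF.hasFDerivAt hx.2).const_mul μ)) h1
    refine IsLocalMin.hasDerivAt_eq_zero ?_ hd
    filter_upwards [IsNormalBarrier.eventually_mem_line isOpen_interior hx.2 h] with t ht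
    have := hmin (x + t • h) ⟨by simpa [hh] using hx.1, ht⟩
    simpa using this
  obtain ⟨y, hy⟩ := exists_Aadj_eq hA hker
  refine ⟨(x, -(μ • grad P.F x), y + y₀), hx.2, hx.1, ?_, rfl⟩
  simp only [map_add, ← hy, ← hy₀]
  abel

theorem grad_f (hF : IsNormalBarrier P.K P.ν P.F) (hK : IsRegularCone P.K)
    (hfeas : P.StrictlyFeasible) {y : H} (hy : y ∈ interior P.Q) :
    grad P.f y = P.A (legendrePoint P.K P.F (P.slack y)) := by
  have h1 := HasFDerivAt.comp y (hF.hasFDerivAt_dualBarrier hK (slack_mem_interior hfeas hy))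
    (P.Aadj.hasFDerivAt.const_sub P.c)
  refine (h1.congr_fderiv ?_).fderiv
  ext h
  simp [Aadj_apply]

theorem hess_f (hF : IsNormalBarrier P.K P.ν P.F) (hK : IsRegularCone P.K)
    (hfeas : P.StrictlyFeasible) {y : H} (hy : y ∈ interior P.Q) :
    hess P.f y =
      P.A ∘L (hess P.F (legendrePoint P.K P.F (P.slack y))).inverse ∘L P.A.flip := by
  have h1 := HasFDerivAt.comp y (hF.hasFDerivAt_legendrePoint hK (slack_mem_interior hfeas hy))
    (P.Aadj.hasFDerivAt.const_sub P.c)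
  have h2 := HasFDerivAt.comp y P.A.hasFDerivAt h1
  refine ((h2.congr_of_eventuallyEq ?_).congr_fderiv ?_).fderiv
  · filter_upwards [isOpen_interior.mem_nhds hy] with y' hy'
    exact grad_f hF hK hfeas hy'
  · ext h k
    simp [Aadj]

variable [FiniteDimensional ℝ H]

theorem isCentralPoint_centralPath (hF : IsNormalBarrier P.K P.ν P.F)
    (hA : Function.Surjective P.A) (hfeas : P.StrictlyFeasible) {μ : ℝ} (hμ : 0 < μ) :
    P.IsCentralPoint μ (P.centralPath μ) :=
  Classical.epsilon_spec (exists_isCentralPoint hF hA hfeas hμ)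

end ConicProblem

end ConicIPM

/-! ### Estimates on the central path and in its neighbourhood. -/

namespace ConicIPM

namespace ConicProblem

variable {E H : Type*} [NormedAddCommGroup E] [NormedSpace ℝ E] [FiniteDimensional ℝ E]
  [NormedAddCommGroup H] [NormedSpace ℝ H] [FiniteDimensional ℝ H] {P : ConicProblem E H}

theorem xC_mem (hF : IsNormalBarrier P.K P.ν P.F)
    (hA : Function.Surjective P.A) (hfeas : P.StrictlyFeasible) {μ : ℝ} (hμ : 0 < μ) :
    P.xC μ ∈ interior (P.K : Set E) :=
  (isCentralPoint_centralPath hF hA hfeas hμ).1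

theorem B_spd (hF : IsNormalBarrier P.K P.ν P.F) (hK : IsRegularCone P.K)
    (hA : Function.Surjective P.A) (hfeas : P.StrictlyFeasible) : IsSPD P.B :=
  hF.spd hK (xC_mem hF hA hfeas one_pos)

theorem G_spd (hF : IsNormalBarrier P.K P.ν P.F) (hK : IsRegularCone P.K)
    (hA : Function.Surjective P.A) (hfeas : P.StrictlyFeasible) : IsSPD P.G :=
  (B_spd hF hK hA hfeas).conjugate_inverse hA

/-- Sharpness bounds the norm `‖·‖_G` by the local norm at an interior point. -/
theorem opNorm_G_le (hF : IsNormalBarrier P.K P.ν P.F) (hK : IsRegularCone P.K)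
    (hA : Function.Surjective P.A) (hfeas : P.StrictlyFeasible) {yStar : H} {γd : ℝ}
    (hsharp : P.SharpDual yStar γd) {y : H} (hy : y ∈ interior P.Q) (h : H) :
    opNorm P.G h ≤ 2 * (P.fStar - P.b y) / γd *
      opDualNorm (hess P.F (legendrePoint P.K P.F (P.slack y))) (P.Aadj h) := by
  have hs := slack_mem_interior hfeas hy
  obtain ⟨hz, hgz⟩ := hF.legendrePoint_spec hK hs
  set z := legendrePoint P.K P.F (P.slack y)
  have hG := G_spd hF hK hA hfeas
  obtain ⟨hγ, hsharp⟩ := hsharp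
  have hN := (hF.spd hK hz).conjugate_inverse hA
  change opNorm P.G h ≤ _ * opNorm (P.A ∘L (hess P.F z).inverse ∘L P.A.flip) h
  rcases eq_or_ne h 0 with rfl | hh
  · simp [IsSPD.opNorm_zero]
  have hτ := hN.opNorm_pos hh
  set N := P.A ∘L (hess P.F z).inverse ∘L P.A.flip with hNdef
  have hQ : ∀ w, opNorm N w ≤ 1 → y + w ∈ P.Q := by
    intro w hw
    have h1 := hF.smul_neg_grad_add_mem hK hz (w := P.Aadj (-w)) (τ := 1) (by
      change opNorm N (-w) ≤ 1
      rwa [IsSPD.opNorm_neg])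
    change P.slack (y + w) ∈ dualCone P.K
    rw [slack_add]
    simpa [hgz, sub_eq_add_neg] using h1
  -- If `⟨b, w⟩ ≥ 0`, the gap at `y + w` is no larger than at `y`, so sharpness places both points
  -- within `Δ/γ_d` of `y_*`. The other sign follows by replacing `w` with `-w`.
  have hdir : ∀ w, opNorm N w ≤ 1 → 0 ≤ P.b w → opNorm P.G w ≤ 2 * (P.fStar - P.b y) / γd := by
    intro w hw hbw
    have h1 := hsharp _ (hQ w hw)
    have h2 := hsharp y (interior_subset hy)
    have h3 := hG.opNorm_add_le (y + w - yStar) (-(y - yStar))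
    rw [IsSPD.opNorm_neg, show y + w - yStar + -(y - yStar) = w by abel] at h3
    rw [map_add] at h1
    rw [le_div_iff₀ hγ]
    nlinarith
  have hunit : ∀ w, opNorm N w ≤ 1 → opNorm P.G w ≤ 2 * (P.fStar - P.b y) / γd := by
    intro w hw
    rcases le_total 0 (P.b w) with hb | hb
    · exact hdir w hw hb
    · have := hdir (-w) (by rwa [IsSPD.opNorm_neg]) (by simpa using hb)
      rwa [IsSPD.opNorm_neg] at this
  have h1 := hunit ((opNorm N h)⁻¹ • h) (by
    rw [IsSPD.opNorm_smul, abs_of_pos (inv_pos.2 hτ), inv_mul_cancel₀ hτ.ne'])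
  rw [IsSPD.opNorm_smul, abs_of_pos (inv_pos.2 hτ), inv_mul_le_iff₀ hτ] at h1
  linarith

theorem legendrePoint_sC (hF : IsNormalBarrier P.K P.ν P.F) (hK : IsRegularCone P.K)
    (hA : Function.Surjective P.A) (hfeas : P.StrictlyFeasible) {μ : ℝ} (hμ : 0 < μ) :
    legendrePoint P.K P.F (P.sC μ) = μ⁻¹ • P.xC μ := by
  have hc := isCentralPoint_centralPath hF hA hfeas hμ
  have hx := xC_mem hF hA hfeas hμ
  apply hF.legendrePoint_eq hK (smul_mem_interior (inv_pos.2 hμ) hx)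
  rw [hF.grad_smul hx (inv_pos.2 hμ), inv_inv, sC, hc.2.2.2, neg_neg]
  rfl

theorem sC_mem (hF : IsNormalBarrier P.K P.ν P.F) (hK : IsRegularCone P.K)
    (hA : Function.Surjective P.A) (hfeas : P.StrictlyFeasible) {μ : ℝ} (hμ : 0 < μ) :
    P.sC μ ∈ interior (dualCone P.K) := by
  have hc := isCentralPoint_centralPath hF hA hfeas hμ
  rw [sC, hc.2.2.2, show -(μ • grad P.F (P.centralPath μ).1) =
    μ • -grad P.F (P.centralPath μ).1 by module]
  exact smul_mem_interior_dualCone hμ (hF.neg_grad_mem hK hc.1)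

theorem sC_apply_xC (hF : IsNormalBarrier P.K P.ν P.F)
    (hA : Function.Surjective P.A) (hfeas : P.StrictlyFeasible) {μ : ℝ} (hμ : 0 < μ) :
    P.sC μ (P.xC μ) = μ * P.ν := by
  have hc := isCentralPoint_centralPath hF hA hfeas hμ
  rw [sC, hc.2.2.2, neg_apply, smul_apply, xC, hF.grad_self hc.1, smul_eq_mul]
  ring

theorem slack_yC (hF : IsNormalBarrier P.K P.ν P.F)
    (hA : Function.Surjective P.A) (hfeas : P.StrictlyFeasible) {μ : ℝ} (hμ : 0 < μ) :
    P.slack (P.centralPath μ).2.2 = P.sC μ :=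
  (isCentralPoint_centralPath hF hA hfeas hμ).slack_eq

theorem slack_apply_xC (hF : IsNormalBarrier P.K P.ν P.F)
    (hA : Function.Surjective P.A) (hfeas : P.StrictlyFeasible) {μ : ℝ} (hμ : 0 < μ) (y : H) :
    P.slack y (P.xC μ) = P.c (P.xC μ) - P.b y := by
  rw [slack_apply, xC, (isCentralPoint_centralPath hF hA hfeas hμ).2.1]

theorem slack_optimal_apply_le (hF : IsNormalBarrier P.K P.ν P.F) (hK : IsRegularCone P.K)
    (hA : Function.Surjective P.A) (hfeas : P.StrictlyFeasible) {yStar : H}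
    (hopt : P.IsDualOptimal yStar) {μ : ℝ} (hμ : 0 < μ) :
    P.slack yStar (P.xC μ) ≤ μ * P.ν := by
  rw [← sC_apply_xC hF hA hfeas hμ, ← slack_yC hF hA hfeas hμ, slack_apply_xC hF hA hfeas hμ,
    slack_apply_xC hF hA hfeas hμ]
  have := hopt.2 (P.centralPath μ).2.2 (by
    change P.slack _ ∈ dualCone P.K
    rw [slack_yC hF hA hfeas hμ]
    exact interior_subset (sC_mem hF hK hA hfeas hμ))
  linarith

/-- Feasibility makes `s_1 - s_μ` orthogonal to `x_1 - x_μ`, so `⟨s_1, x_μ⟩ = ν + μν - ⟨s_μ, x_1⟩`.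
-/
theorem sC_one_apply_le (hF : IsNormalBarrier P.K P.ν P.F) (hK : IsRegularCone P.K)
    (hA : Function.Surjective P.A) (hfeas : P.StrictlyFeasible) {μ : ℝ} (hμ : μ ∈ Ioc (0 : ℝ) 1) :
    P.sC 1 (P.xC μ) ≤ 2 * P.ν := by
  have h1 := slack_apply_xC hF hA hfeas hμ.1 (P.centralPath 1).2.2
  have h2 := slack_apply_xC hF hA hfeas one_pos (P.centralPath μ).2.2
  have h3 := slack_apply_xC hF hA hfeas hμ.1 (P.centralPath μ).2.2
  have h4 := slack_apply_xC hF hA hfeas one_pos (P.centralPath 1).2.2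
  rw [slack_yC hF hA hfeas one_pos] at h1 h4
  rw [slack_yC hF hA hfeas hμ.1] at h2 h3
  rw [sC_apply_xC hF hA hfeas hμ.1] at h3
  rw [sC_apply_xC hF hA hfeas one_pos] at h4
  have h5 := interior_subset (sC_mem hF hK hA hfeas hμ.1) _
    (interior_subset (xC_mem hF hA hfeas one_pos))
  have hν := hF.nu_nonneg (xC_mem hF hA hfeas one_pos)
  nlinarith [hμ.2]

/-- Points of the neighbourhood are close to the central path in the local norm. -/
theorem local_norm_sub_le (hF : IsNormalBarrier P.K P.ν P.F) (hK : IsRegularCone P.K)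
    (hA : Function.Surjective P.A) (hfeas : P.StrictlyFeasible) {μ β : ℝ} (hμ : 0 < μ)
    {y : H} (hy : y ∈ P.neighborhood μ β) :
    opNorm (hess P.Fdual (P.slack y)) (P.sC μ - P.slack y) * (1 - β) ≤ β := by
  obtain ⟨hyQ, hyβ⟩ := hy
  have hβ0 : 0 ≤ β := (Real.sqrt_nonneg _).trans hyβ
  have hs := slack_mem_interior hfeas hyQ
  have hsμ := sC_mem hF hK hA hfeas hμ
  have h1 := (hF.isSelfConcordantGrad_dualBarrier hK).le_grad_sub hs hsμ
  rw [hF.grad_dualBarrier hK hs, hF.grad_dualBarrier hK hsμ,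
    legendrePoint_sC hF hK hA hfeas hμ] at h1
  -- Through this identity the change of `∇F_*` paired with `s_μ - s(y)` becomes `⟨∇f(y) - b/μ, y -
  -- y_μ⟩ ≤ βδ`, with `δ` the local norm of `s_μ - s(y)`.
  have hdiff : P.sC μ - P.slack y = P.Aadj (y - (P.centralPath μ).2.2) := by
    rw [← slack_yC hF hA hfeas hμ, slack, slack, map_sub]
    abel
  have h2 : opNorm (hess P.Fdual (P.slack y)) (P.sC μ - P.slack y) =
      opNorm (hess P.f y) (y - (P.centralPath μ).2.2) := by
    rw [Fdual, hF.opNorm_hess_dualBarrier hK hs, hdiff, hess_f hF hK hfeas hyQ]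
    rfl
  have h3 : IsSPD (hess P.f y) := by
    rw [hess_f hF hK hfeas hyQ]
    exact (hF.spd hK (hF.legendrePoint_mem hK hs)).conjugate_inverse hA
  have h4 := h3.dual_apply_le (grad P.f y - μ⁻¹ • P.b) (y - (P.centralPath μ).2.2)
  have hAx : P.A (P.xC μ) = P.b := (isCentralPoint_centralPath hF hA hfeas hμ).2.1
  rw [← h2, grad_f hF hK hfeas hyQ, ← hAx, ← map_smul, ← map_sub, ← Aadj_apply, ← hdiff] at h4
  rw [grad_f hF hK hfeas hyQ, ← hAx, ← map_smul, ← map_sub] at hyβ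
  change opNorm (hess P.Fdual (P.slack y)) _ ^ 2 / (1 + opNorm (hess P.Fdual (P.slack y)) _) ≤ _ at h1
  have h5 := IsSPD.opNorm_nonneg (hess P.Fdual (P.slack y)) (P.sC μ - P.slack y)
  generalize opNorm (hess P.Fdual (P.slack y)) (P.sC μ - P.slack y) = δ at *
  have h6 : δ ^ 2 / (1 + δ) ≤ β * δ := by
    refine h1.trans (le_trans (le_of_eq ?_) (h4.trans (mul_le_mul_of_nonneg_right hyβ h5)))
    simp only [neg_apply, NormedSpace.dual_def, sub_apply, map_sub]
    ring
  rw [div_le_iff₀ (by positivity)] at h6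
  rcases h5.eq_or_lt with h0 | h0
  · rw [← h0]; simpa using hβ0
  · have h7 : δ * δ ≤ δ * (β * (1 + δ)) := by linarith
    have := le_of_mul_le_mul_left h7 h0
    linarith

/-- The two Hessians agree up to a factor `(1-δ)^(±2)`, where `1-δ ≥ (1-2β)/(1-β)` by
`local_norm_sub_le`. -/
theorem hess_Fdual_sub_le (hF : IsNormalBarrier P.K P.ν P.F) (hK : IsRegularCone P.K)
    (hA : Function.Surjective P.A) (hfeas : P.StrictlyFeasible) {μ β : ℝ} (hμ : 0 < μ)
    (hβ : β ≤ 1 / 9) {y : H} (hy : y ∈ P.neighborhood μ β) (u : StrongDual ℝ E) :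
    |(hess P.Fdual (P.slack y) - hess P.Fdual (P.sC μ)) u u| ≤
      3 * β * hess P.Fdual (P.sC μ) u u := by
  have hβ0 : 0 ≤ β := (Real.sqrt_nonneg _).trans hy.2
  have hs := slack_mem_interior hfeas hy.1
  have hsμ := sC_mem hF hK hA hfeas hμ
  have hδ := local_norm_sub_le hF hK hA hfeas hμ hy
  have hSC := hF.isSelfConcordantGrad_dualBarrier hK
  have hlt : opNorm (hess P.Fdual (P.slack y)) (P.sC μ - P.slack y) < 1 := by
    by_contra hge
    push Not at hge
    nlinarith
  obtain ⟨h1, h2⟩ := hSC.hess_le hs hsμ hlt u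
  have hp1 := (hSC.spd _ hs).nonneg u
  have hp2 := (hSC.spd _ hsμ).nonneg u
  change (1 - opNorm (hess P.Fdual (P.slack y)) _) ^ 2 * hess P.Fdual (P.sC μ) u u ≤
    hess P.Fdual (P.slack y) u u at h1
  change (1 - opNorm (hess P.Fdual (P.slack y)) _) ^ 2 * hess P.Fdual (P.slack y) u u ≤
    hess P.Fdual (P.sC μ) u u at h2
  change 0 ≤ hess P.Fdual (P.slack y) u u at hp1
  change 0 ≤ hess P.Fdual (P.sC μ) u u at hp2
  rw [sub_apply, sub_apply]
  generalize opNorm (hess P.Fdual (P.slack y)) (P.sC μ - P.slack y) = δ at *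
  generalize hess P.Fdual (P.slack y) u u = a at *
  generalize hess P.Fdual (P.sC μ) u u = c at *
  set p := (1 - δ) ^ 2 with hp
  have hβ1 : 0 < (1 - β) ^ 2 := by
    have : 0 < 1 - β := by linarith
    positivity
  have hpβ : (1 - 2 * β) ^ 2 ≤ p * (1 - β) ^ 2 := by
    rw [hp, ← mul_pow]
    apply pow_le_pow_left₀ (by linarith)
    linarith
  -- The difference of the two sides is `β(1 - 9β + 12β²)`; this is where `β ≤ 1/9` enters.
  have hpoly : (1 - β) ^ 2 ≤ (1 + 3 * β) * (1 - 2 * β) ^ 2 := by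
    have : 0 ≤ β * (1 - 9 * β + 12 * β ^ 2) := mul_nonneg hβ0 (by nlinarith)
    nlinarith
  have hp1' : 1 ≤ (1 + 3 * β) * p := by
    have h3 : (1 - β) ^ 2 * 1 ≤ (1 - β) ^ 2 * ((1 + 3 * β) * p) := by
      calc (1 - β) ^ 2 * 1 ≤ (1 + 3 * β) * (1 - 2 * β) ^ 2 := by linarith
        _ ≤ (1 + 3 * β) * (p * (1 - β) ^ 2) := by gcongr
        _ = _ := by ring
    exact le_of_mul_le_mul_left h3 hβ1
  rw [abs_le]
  constructor
  · have : 1 - 3 * β ≤ p := by nlinarith [sq_nonneg (1 - δ)]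
    nlinarith
  · have h4 : 1 * a ≤ (1 + 3 * β) * p * a := by gcongr
    have h5 : (1 + 3 * β) * (p * a) ≤ (1 + 3 * β) * c := by gcongr
    linarith

/-- The vector `∇²F_*(s(y)) s_*` is bounded in the neighbourhood of the central path. -/
theorem opNorm_inverse_slack_le (hF : IsNormalBarrier P.K P.ν P.F) (hK : IsRegularCone P.K)
    (hA : Function.Surjective P.A) (hfeas : P.StrictlyFeasible) {yStar : H}
    (hopt : P.IsDualOptimal yStar) {σd : ℝ} (hbound : P.BoundedAlongPath yStar σd) {μ β : ℝ}
    (hμ : μ ∈ Ioc (0 : ℝ) 1) (hβ : β ≤ 1 / 9) {y : H} (hy : y ∈ P.neighborhood μ β) :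
    opNorm P.B ((hess P.F (legendrePoint P.K P.F (P.slack y))).inverse (P.slack yStar)) ≤
      σd + 6 * P.ν ^ 2 / μ * β := by
  have hβ0 : 0 ≤ β := (Real.sqrt_nonneg _).trans hy.2
  have hμ0 := hμ.1
  have hs := slack_mem_interior hfeas hy.1
  have hsμ := sC_mem hF hK hA hfeas hμ.1
  have hSC := hF.isSelfConcordantGrad_dualBarrier hK
  have hx1 := xC_mem hF hA hfeas one_pos
  have hν := hF.nu_nonneg hx1
  have hm := hF.legendrePoint_mem hK hsμ
  have hleg := legendrePoint_sC hF hK hA hfeas hμ.1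
  set m := legendrePoint P.K P.F (P.sC μ) with hmdef
  set z := legendrePoint P.K P.F (P.slack y) with hzdef
  have hBm := hF.spd hK hm
  set t := P.slack yStar with ht
  set e := (hess P.F z).inverse t - (hess P.F m).inverse t with he
  -- Testing the difference of Hessians against `∇²F(m) e` turns the left side into `‖e‖²` in the
  -- local norm at `m`, so `‖e‖ ≤ 3β‖s_*‖`.
  have hD := (hSC.spd _ hsμ).abs_bilinear_le
    (hess P.Fdual (P.slack y) - hess P.Fdual (P.sC μ))
    (fun u v => by
      rw [sub_apply, sub_apply, sub_apply, sub_apply]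
      exact congrArg₂ _ ((hSC.spd _ hs).symm u v) ((hSC.spd _ hsμ).symm u v))
    (hess_Fdual_sub_le hF hK hA hfeas hμ.1 hβ hy) t (hess P.F m e)
  have h1 : (hess P.Fdual (P.slack y) - hess P.Fdual (P.sC μ)) t (hess P.F m e) =
      opNorm (hess P.F m) e ^ 2 := by
    rw [sub_apply, sub_apply, Fdual, hF.hess_dualBarrier_apply hK hs,
      hF.hess_dualBarrier_apply hK hsμ, ← map_sub, hBm.sq_opNorm]
  rw [h1, hF.opNorm_hess_dualBarrier hK hsμ, hF.opNorm_hess_dualBarrier hK hsμ, ← hmdef,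
    ← hBm.opNorm_inverse (hess P.F m e), hBm.inverse_apply, abs_of_nonneg (sq_nonneg _)] at hD
  have h2 : opDualNorm (hess P.F m) t ≤ P.ν := by
    refine (hF.opDualNorm_le_apply hK hsμ hopt.1).trans ?_
    rw [← hmdef, hleg, map_smul, smul_eq_mul, inv_mul_le_iff₀ hμ0]
    exact slack_optimal_apply_le hF hK hA hfeas hopt hμ0
  have h3 : opNorm (hess P.F m) e ≤ 3 * β * P.ν := by
    have h0 := IsSPD.opNorm_nonneg (hess P.F m) e
    have h4 : opNorm (hess P.F m) e ^ 2 ≤ 3 * β * P.ν * opNorm (hess P.F m) e := by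
      refine hD.trans ?_
      rw [mul_assoc (3 * β)]
      gcongr
    rcases h0.eq_or_lt with h5 | h5
    · rw [← h5]; positivity
    · exact le_of_mul_le_mul_right (by rwa [← sq]) h5
  -- Passing from the local norm at `m = x_μ/μ` to `‖·‖_B` costs the factor `-⟨∇F(x_1), m⟩ = ⟨s_1,
  -- x_μ⟩/μ`.
  have h4 : opNorm P.B e ≤ 2 * P.ν / μ * (3 * β * P.ν) := by
    refine (hF.opNorm_le_mul_opNorm hK hx1 hm e).trans ?_
    have h5 : -(grad P.F (P.xC 1) m) = μ⁻¹ * P.sC 1 (P.xC μ) := by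
      rw [sC, (isCentralPoint_centralPath hF hA hfeas one_pos).2.2.2, hleg, one_smul, map_smul,
        neg_apply, smul_eq_mul, mul_neg]
      rfl
    have h6 : -(grad P.F (P.xC 1) m) ≤ 2 * P.ν / μ := by
      rw [h5, inv_mul_le_iff₀ hμ0, mul_div_cancel₀ _ hμ0.ne']
      exact sC_one_apply_le hF hK hA hfeas hμ
    have := IsSPD.opNorm_nonneg (hess P.F m) e
    gcongr
  have h5 : opNorm P.B ((hess P.F m).inverse t) ≤ σd := by
    have h6 := hbound μ hμ
    rwa [Fdual, hF.hess_dualBarrier hK hsμ, ContinuousLinearMap.comp_apply,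
      ofBidual_inclusion] at h6
  have h6 := (B_spd hF hK hA hfeas).opNorm_add_le ((hess P.F m).inverse t) e
  rw [he, add_sub_cancel, ← he] at h6
  calc _ ≤ σd + 2 * P.ν / μ * (3 * β * P.ν) := h6.trans (add_le_add h5 h4)
    _ = _ := by ring

/-- The predictor step lands at `y_*` up to an error measured by `∇²F_*(s(y)) s_*`. -/
theorem hess_f_predictor (hF : IsNormalBarrier P.K P.ν P.F) (hK : IsRegularCone P.K)
    (hA : Function.Surjective P.A) (hfeas : P.StrictlyFeasible) {y : H} (hy : y ∈ interior P.Q)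
    (yStar : H) :
    hess P.f y (y + P.v y - yStar) =
      P.A ((hess P.F (legendrePoint P.K P.F (P.slack y))).inverse (P.slack yStar)) := by
  have hs := slack_mem_interior hfeas hy
  obtain ⟨hz, hgz⟩ := hF.legendrePoint_spec hK hs
  have hB := hF.spd hK hz
  have hN : IsSPD (hess P.f y) := by
    rw [hess_f hF hK hfeas hy]
    exact hB.conjugate_inverse hA
  rw [show y + P.v y - yStar = (y - yStar) + P.v y by abel, map_add, v, hN.apply_inverse,
    grad_f hF hK hfeas hy, hess_f hF hK hfeas hy]
  set z := legendrePoint P.K P.F (P.slack y)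
  -- This puts `∇f(y) = A z` in the form `A [∇²F(z)]⁻¹ s(y)`, which cancels the `-s(y)` in `A*(y -
  -- y_*) = s_* - s(y)`.
  have h1 : z = (hess P.F z).inverse (P.slack y) := by
    have h := hB.inverse_apply z
    rw [hF.hess_self hz, hgz, neg_neg] at h
    exact h.symm
  have h2 : P.A.flip (y - yStar) = P.slack yStar - P.slack y := by
    simp only [slack, Aadj, map_sub]; abel
  simp only [ContinuousLinearMap.comp_apply, h2]
  nth_rewrite 2 [h1]
  rw [← map_add, ← map_add, sub_add_cancel]

end ConicProblem

end ConicIPM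

/-! ### The predictor step. -/

namespace ConicIPM

namespace ConicProblem

variable {E H : Type*} [NormedAddCommGroup E] [NormedSpace ℝ E] [FiniteDimensional ℝ E]
  [NormedAddCommGroup H] [NormedSpace ℝ H] [FiniteDimensional ℝ H] {P : ConicProblem E H}

/-- The local norm of the distance from the full predictor step to the optimal solution. -/
theorem opDualNorm_predictor_le (hF : IsNormalBarrier P.K P.ν P.F) (hK : IsRegularCone P.K)
    (hA : Function.Surjective P.A) (hfeas : P.StrictlyFeasible) {yStar : H} {γd : ℝ}
    (hsharp : P.SharpDual yStar γd) {y : H} (hy : y ∈ interior P.Q) :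
    opDualNorm (hess P.F (legendrePoint P.K P.F (P.slack y))) (P.Aadj (y + P.v y - yStar)) ≤
      2 * (P.fStar - P.b y) / γd *
        opNorm P.B ((hess P.F (legendrePoint P.K P.F (P.slack y))).inverse (P.slack yStar)) := by
  have hs := slack_mem_interior hfeas hy
  have hz := hF.legendrePoint_mem hK hs
  have hp := hess_f_predictor hF hK hA hfeas hy yStar
  have hG := opNorm_G_le hF hK hA hfeas hsharp hy (y + P.v y - yStar)
  rw [hess_f hF hK hfeas hy] at hp
  set d := y + P.v y - yStar
  set z := legendrePoint P.K P.F (P.slack y)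
  set w := (hess P.F z).inverse (P.slack yStar)
  set n := opDualNorm (hess P.F z) (P.Aadj d) with hn
  have hn0 : 0 ≤ n := Real.sqrt_nonneg _
  have hw0 := IsSPD.opNorm_nonneg P.B w
  have h1 : n ^ 2 = P.Aadj d w := by
    rw [hn, (hF.spd hK hz).sq_opDualNorm]
    exact DFunLike.congr_fun hp d
  have h2 : P.Aadj d w ≤ opNorm P.G d * opNorm P.B w :=
    (B_spd hF hK hA hfeas).dual_apply_le (P.Aadj d) w
  rcases hn0.eq_or_lt with h0 | h0
  · have h3 := hsharp.2 y (interior_subset hy)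
    have h4 : 0 ≤ P.fStar - P.b y :=
      (mul_nonneg hsharp.1.le (IsSPD.opNorm_nonneg _ _)).trans h3
    rw [← h0]
    have := hsharp.1
    positivity
  · refine le_of_mul_le_mul_right ?_ h0
    calc n * n = P.Aadj d w := by rw [← h1, sq]
      _ ≤ opNorm P.G d * opNorm P.B w := h2
      _ ≤ 2 * (P.fStar - P.b y) / γd * n * opNorm P.B w := by gcongr
      _ = _ := by ring

/-- Cauchy–Schwarz in `B` for `⟨b, h⟩ = ⟨A* h, x_1⟩`, since `‖x_1‖_B² = ν` by homogeneity. -/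
theorem b_apply_le (hF : IsNormalBarrier P.K P.ν P.F) (hK : IsRegularCone P.K)
    (hA : Function.Surjective P.A) (hfeas : P.StrictlyFeasible) (h : H) :
    |P.b h| ≤ √P.ν * opNorm P.G h := by
  have h1 := (B_spd hF hK hA hfeas).abs_dual_apply_le (P.Aadj h) (P.xC 1)
  have h2 : opNorm P.B (P.xC 1) = √P.ν := by
    rw [opNorm, B, hF.hess_self_self (xC_mem hF hA hfeas one_pos)]
  have h3 : P.A (P.xC 1) = P.b := (isCentralPoint_centralPath hF hA hfeas one_pos).2.1
  rw [h2, Aadj_apply, h3, mul_comm] at h1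
  exact h1

end ConicProblem

end ConicIPM

end

theorem mainTheorem5 {E H : Type*}
    [NormedAddCommGroup E] [NormedSpace ℝ E] [FiniteDimensional ℝ E]
    [NormedAddCommGroup H] [NormedSpace ℝ H] [FiniteDimensional ℝ H]
    (P : ConicIPM.ConicProblem E H)
    (hK : ConicIPM.IsRegularCone P.K)
    (hF : ConicIPM.IsNormalBarrier P.K P.ν P.F)
    (hA : Function.Surjective P.A)
    (hfeas : P.StrictlyFeasible)
    (yStar : H) (hopt : P.IsDualOptimal yStar)
    (γd σd : ℝ) (hsharp : P.SharpDual yStar γd) (hbound : P.BoundedAlongPath yStar σd)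
    (μ β : ℝ) (hμ : μ ∈ Set.Ioc (0 : ℝ) 1) (hβ : β ∈ Set.Icc (0 : ℝ) (1 / 9))
    (y : H) (hy : y ∈ P.neighborhood μ β)
    (r : ℝ) (hr : r ∈ Set.Ioo (0 : ℝ) 1) :
    y + P.alphaHat γd σd μ β r y • P.v y ∈ P.Q ∧
      P.fStar - P.b (y + P.alphaHat γd σd μ β r y • P.v y) ≤
        P.kappa₃ γd σd μ β r * (P.fStar - P.b y) ^ 2 := by
  have hyQ := hy.1
  have hsy := ConicIPM.ConicProblem.slack_mem_interior hfeas hyQ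
  have hSP := P.opDualNorm_predictor_le hF hK hA hfeas hsharp hyQ
  have hS := P.opNorm_inverse_slack_le hF hK hA hfeas hopt hbound hμ hβ.2 hy
  have hG := P.opNorm_G_le hF hK hA hfeas hsharp hyQ (y + P.v y - yStar)
  have hb := P.b_apply_le hF hK hA hfeas (y + P.v y - yStar)
  have hΔ : 0 ≤ P.fStar - P.b y := by
    rw [ConicIPM.ConicProblem.fStar_eq hopt, sub_nonneg]
    exact hopt.2 y (interior_subset hyQ)
  have hγ := hsharp.1
  set z := ConicIPM.legendrePoint P.K P.F (P.slack y) with hz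
  set κ := P.kappa₂ γd σd μ β with hκ
  set Δ := P.fStar - P.b y with hΔdef
  set d := y + P.v y - yStar with hd
  set n := ConicIPM.opDualNorm (ConicIPM.hess P.F z) (P.Aadj d) with hn
  have hn0 : 0 ≤ n := Real.sqrt_nonneg _
  have hσ := (ConicIPM.IsSPD.opNorm_nonneg P.B _).trans hS
  have hκ0 : 0 ≤ κ := mul_nonneg (by positivity) hσ
  have hnκ : n ≤ κ * Δ := by
    calc n ≤ 2 * Δ / γd * (σd + 6 * P.ν ^ 2 / μ * β) :=
          hSP.trans (mul_le_mul_of_nonneg_left hS (by positivity))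
      _ = κ * Δ := by rw [hκ, ConicIPM.ConicProblem.kappa₂]; ring
  have hden : 0 < r + κ * Δ := by have := hr.1; positivity
  set α := P.alphaHat γd σd μ β r y with hα
  have hα' : α = r / (r + κ * Δ) := rfl
  have hα0 : 0 ≤ α := by rw [hα']; exact div_nonneg hr.1.le hden.le
  have hα1 : 1 - α = κ * Δ / (r + κ * Δ) := by rw [hα']; field_simp; ring
  have hα1le : α ≤ 1 := by
    have : 0 ≤ 1 - α := by rw [hα1]; positivity
    linarith
  have hv : y + α • P.v y = (1 - α) • y + α • yStar + α • d := by rw [hd]; module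
  constructor
  · change P.slack (y + α • P.v y) ∈ ConicIPM.dualCone P.K
    -- Both sides have denominator `r + κΔ`; the claim reduces to `r n ≤ κΔ`, which holds as `r <
    -- 1`.
    have hαn : α * n ≤ 1 - α := by
      rw [hα1, hα', div_mul_eq_mul_div]
      refine div_le_div_of_nonneg_right ?_ hden.le
      calc r * n ≤ 1 * n := by gcongr; exact hr.2.le
        _ ≤ κ * Δ := by rwa [one_mul]
    have hdikin := hF.smul_neg_grad_add_mem hK (hF.legendrePoint_mem hK hsy)
      (w := P.Aadj ((-α) • d)) (τ := 1 - α) (by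
        change ConicIPM.opNorm (P.A ∘L (ConicIPM.hess P.F z).inverse ∘L P.A.flip) _ ≤ _
        rw [ConicIPM.IsSPD.opNorm_smul, abs_neg, abs_of_nonneg hα0]
        exact hαn)
    rw [hF.grad_legendrePoint hK hsy, neg_neg] at hdikin
    -- The new slack is `[(1-α)s(y) - αA*d] + αs_*`; the bracket lies in the scaled Dikin ellipsoid,
    -- hence in the dual cone.
    have hadd := ConicIPM.add_mem_dualCone hdikin
      (ConicIPM.smul_mem_dualCone hα0 (hopt.1 : P.slack yStar ∈ ConicIPM.dualCone P.K))
    convert hadd using 1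
    rw [hv]
    simp only [ConicIPM.ConicProblem.slack, map_add, map_smul]
    module
  · have hbd : -(P.b d) ≤ √P.ν * (2 * Δ / γd * (κ * Δ)) := by
      calc -(P.b d) ≤ |P.b d| := neg_le_abs _
        _ ≤ √P.ν * ConicIPM.opNorm P.G d := hb
        _ ≤ √P.ν * (2 * Δ / γd * n) := by gcongr
        _ ≤ √P.ν * (2 * Δ / γd * (κ * Δ)) := by gcongr
    have hsplit : P.fStar - P.b (y + α • P.v y) = (1 - α) * Δ + α * -(P.b d) := by
      rw [hv, hΔdef, ConicIPM.ConicProblem.fStar_eq hopt]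
      simp only [map_add, map_smul, smul_eq_mul]
      ring
    have h1 : (1 - α) * Δ ≤ κ * Δ / r * Δ := by
      rw [hα1]
      have := hr.1
      have := mul_nonneg hκ0 hΔ
      gcongr
      linarith
    have h2 : α * -(P.b d) ≤ 1 * (√P.ν * (2 * Δ / γd * (κ * Δ))) :=
      (mul_le_mul_of_nonneg_left hbd hα0).trans
        (mul_le_mul_of_nonneg_right hα1le (by positivity))
    rw [hsplit]
    calc _ ≤ κ * Δ / r * Δ + 1 * (√P.ν * (2 * Δ / γd * (κ * Δ))) := add_le_add h1 h2
      _ = P.kappa₃ γd σd μ β r * Δ ^ 2 := by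
        rw [ConicIPM.ConicProblem.kappa₃, ← hκ]; ring
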